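/- Let $\Sigma$ be a datatypes signature, that is, a finite many-sorted signature (with equality on every sort) whose sorts are the disjoint union $\mathbf{Elem}_\Sigma\uplus\mathbf{Struct}_\Sigma$ of element sorts and struct sorts, whose function symbols are constructors $c:\sigma_1\times\dots\times\sigma_n\to\sigma$ with $\sigma\in\mathbf{Struct}_\Sigma$, together with one selector $s_{c,i}:\sigma\to\sigma_i$ for each constructor $c:\sigma_1\times\dots\times\sigma_n\to\sigma$ and each $1\le i\le n$, and whose predicate symbols other than equality are one tester $is_c$ on sort $\sigma$ for each such constructor; moreover, every struct sort contains at least one finite tree built by constructors from elements of the element sorts, when each element sort is interpreted as a one-element set. (Struct sorts may be inductive or finite, in any mixture.) There are countably infinitely many variables of each sort. For a family $D=(D_\sigma)_{\sigma\in\mathbf{Elem}_\Sigma}$ of non-empty sets, a datatypes structure generated by $D$ is a $\Sigma$-structure in which each sort $\sigma$ is interpreted as the set of finite trees of sort $\sigma$ built by constructors from the elements of $D$ (so an element sort $\sigma$ is interpreted as $D_\sigma$), constructors are interpreted as tree formation, $s_{c,i}(c(t_1,\dots,t_n))=t_i$ (with $s_{c,i}$ arbitrary on trees not built by $c$), and $is_c$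 holds exactly of the trees of the form $c(t_1,\dots,t_n)$. Let $\mathcal T_\Sigma$ be the class of all datatypes structures, for all $D$. A $\mathcal T_\Sigma$-interpretation is a structure in $\mathcal T_\Sigma$ with values for the variables; write $\sigma^{\mathcal A}$ and $x^{\mathcal A}$ for the interpretation of a sort $\sigma$ and a variable $x$ in $\mathcal A$. Then $\mathcal T_\Sigma$ is strongly polite with respect to $\mathbf{Elem}_\Sigma$, that is: 1. (Smoothness) For every quantifier-free formula $\phi$, every $\mathcal T_\Sigma$-interpretation $\mathcal A$ satisfying $\phi$, and every choice of cardinals $\kappa(\sigma)\ge|\sigma^{\mathcal A}|$ for $\sigma\in\mathbf{Elem}_\Sigma$, there is a $\mathcal T_\Sigma$-interpretation $\mathcal A'$ satisfying $\phi$ with $|\sigma^{\mathcal A'}|=\kappa(\sigma)$ for all $\sigma\in\mathbf{Elem}_\Sigma$. 2. (Strong finite witnessability) There is a computable function $\mathit{wtn}$ from quantifier-free $\Sigma$-formulas to quantifier-free $\Sigma$-formulas such that, for every $\phi$: (a) $\phi$ and $\exists\vec w.\,\mathit{wtn}(\phi)$ are satisfied by the same $\mathcal T_\Sigma$-interpretations,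 where $\vec w$ are the variables of $\mathit{wtn}(\phi)$ that do not occur in $\phi$; and (b) for every finite set $V$ of variables whose sorts are in $\mathbf{Elem}_\Sigma$ and every arrangement $\delta$ of $V$ (the conjunction of all equations $x=y$ for $x,y\in V$ of the same sort $\sigma$ with $(x,y)\in E_\sigma$ and all disequations $x\ne y$ for $x,y\in V$ of the same sort $\sigma$ with $(x,y)\notin E_\sigma$, for some equivalence relation $E_\sigma$ on the variables of $V$ of sort $\sigma$, for each $\sigma$), if $\mathit{wtn}(\phi)\wedge\delta$ is satisfied by some $\mathcal T_\Sigma$-interpretation, then it is satisfied by a $\mathcal T_\Sigma$-interpretation $\mathcal B$ in which, for every $\sigma\in\mathbf{Elem}_\Sigma$, every element of $\sigma^{\mathcal B}$ is $x^{\mathcal B}$ for some variable $x$ of sort $\sigma$ occurring in $\mathit{wtn}(\phi)\wedge\delta$. -/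

import Mathlib

universe w

namespace DT

/-! ### Many-sorted first-order logic with equality -/

/-- A many-sorted signature. Equality on every sort is built into the formulas below, hence is not
listed among the predicate symbols. -/
structure Signature where
  /-- the sorts -/
  Srt : Type
  /-- the function symbols -/
  Fn : Type
  /-- the predicate symbols other than equality -/
  Pr : Type
  fnArity : Fn → ℕ
  fnDom : (f : Fn) → Fin (fnArity f) → Srt
  fnCod : Fn → Srt
  prArity : Pr → ℕ
  prDom : (p : Pr) → Fin (prArity p) → Srt

/-- Terms of each sort; every sort `σ` has the countably many variables `var σ 0, var σ 1, …`. -/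
inductive Term (L : Signature) : L.Srt → Type
  | var (σ : L.Srt) (n : ℕ) : Term L σ
  | app (f : L.Fn) (args : (i : Fin (L.fnArity f)) → Term L (L.fnDom f i)) : Term L (L.fnCod f)

/-- Quantifier-free formulas. -/
inductive QF (L : Signature) : Type
  | falsum : QF L
  | eq {σ : L.Srt} (t u : Term L σ) : QF L
  | pred (p : L.Pr) (args : (i : Fin (L.prArity p)) → Term L (L.prDom p i)) : QF L
  | neg (φ : QF L) : QF L
  | and (φ ψ : QF L) : QF L
  | or (φ ψ : QF L) : QF L

/-- A variable is a sort together with an index. -/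
abbrev Var (L : Signature) : Type := L.Srt × ℕ

/-- The variables of a term. -/
def Term.vars {L : Signature} : {σ : L.Srt} → Term L σ → Set (Var L)
  | _, .var σ n => {(σ, n)}
  | _, .app _ args => ⋃ i, (args i).vars

/-- The free variables of a quantifier-free formula. -/
def QF.fv {L : Signature} : QF L → Set (Var L)
  | .falsum => ∅
  | .eq t u => t.vars ∪ u.vars
  | .pred _ args => ⋃ i, (args i).vars
  | .neg φ => φ.fv
  | .and φ ψ => φ.fv ∪ ψ.fv
  | .or φ ψ => φ.fv ∪ ψ.fv

/-- The conjunction of a list of formulas; the empty conjunction is the true formula. -/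
def QF.conj {L : Signature} : List (QF L) → QF L
  | [] => .neg .falsum
  | φ :: l => .and φ (QF.conj l)

/-- A many-sorted structure: every sort denotes a non-empty set. -/
structure Structure (L : Signature) where
  carrier : L.Srt → Type w
  nonempty : ∀ σ, Nonempty (carrier σ)
  fn : (f : L.Fn) → ((i : Fin (L.fnArity f)) → carrier (L.fnDom f i)) → carrier (L.fnCod f)
  pr : (p : L.Pr) → ((i : Fin (L.prArity p)) → carrier (L.prDom p i)) → Prop

/-- An assignment of values to the variables. A structure with a valuation is an interpretation. -/
abbrev Structure.Valuation {L : Signature} (A : Structure.{w} L) : Type w :=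
  (σ : L.Srt) → ℕ → A.carrier σ

/-- The value of a term in an interpretation. -/
def Structure.eval {L : Signature} (A : Structure.{w} L) (v : A.Valuation) :
    {σ : L.Srt} → Term L σ → A.carrier σ
  | _, .var σ n => v σ n
  | _, .app f args => A.fn f fun i => A.eval v (args i)

/-- Satisfaction of a quantifier-free formula in an interpretation. -/
def Structure.Sat {L : Signature} (A : Structure.{w} L) (v : A.Valuation) : QF L → Prop
  | .falsum => False
  | .eq t u => A.eval v t = A.eval v u
  | .pred p args => A.pr p fun i => A.eval v (args i)
  | .neg φ => ¬ A.Sat v φ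
  | .and φ ψ => A.Sat v φ ∧ A.Sat v ψ
  | .or φ ψ => A.Sat v φ ∨ A.Sat v ψ

/-- Satisfaction of the formula `∃ W. φ`, where `W` is a set of variables. -/
def Structure.SatEx {L : Signature} (A : Structure.{w} L) (v : A.Valuation) (W : Set (Var L))
    (φ : QF L) : Prop :=
  ∃ v' : A.Valuation, (∀ σ n, (σ, n) ∉ W → v' σ n = v σ n) ∧ A.Sat v' φ

/-- A theory is a class of structures. -/
abbrev Theory (L : Signature) := Set (Structure.{w} L)

/-! ### Codes of formulas, computable functions on formulas -/

/-- The code of a term, relative to a numbering of the symbols. -/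
def Term.code {L : Signature} [Encodable L.Srt] [Encodable L.Fn] :
    {σ : L.Srt} → Term L σ → ℕ
  | _, .var σ n => Nat.pair 0 (Nat.pair (Encodable.encode σ) n)
  | _, .app f args =>
      Nat.pair 1 (Nat.pair (Encodable.encode f)
        (Encodable.encode (List.ofFn fun i => (args i).code)))

/-- The code of a quantifier-free formula, relative to a numbering of the symbols. -/
def QF.code {L : Signature} [Encodable L.Srt] [Encodable L.Fn] [Encodable L.Pr] : QF L → ℕ
  | .falsum => Nat.pair 0 0
  | .eq t u => Nat.pair 1 (Nat.pair t.code u.code)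
  | .pred p args =>
      Nat.pair 2 (Nat.pair (Encodable.encode p)
        (Encodable.encode (List.ofFn fun i => (args i).code)))
  | .neg φ => Nat.pair 3 φ.code
  | .and φ ψ => Nat.pair 4 (Nat.pair φ.code ψ.code)
  | .or φ ψ => Nat.pair 5 (Nat.pair φ.code ψ.code)

/-- A function on quantifier-free formulas is computable if a computable function on the natural
numbers tracks it on codes. For a finite signature the choice of the numbering of the symbols is
immaterial. -/
def ComputableQF {L : Signature} [Encodable L.Srt] [Encodable L.Fn] [Encodable L.Pr]
    (g : QF L → QF L) : Prop :=
  ∃ f : ℕ → ℕ, Computable f ∧ ∀ φ : QF L, f φ.code = (g φ).code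

/-! ### Strong politeness -/

/-- `δ` is an arrangement of the finite set of variables `V`: a conjunction (in any order) of the
equations `x = y` for the pairs in `E σ` and of the disequations `x ≠ y` for the other pairs, where
`E σ` is an equivalence relation on the variables of sort `σ` in `V`, for every sort `σ`. -/
def IsArrangement {L : Signature} (V : Finset (Var L)) (δ : QF L) : Prop :=
  ∃ (E : (σ : L.Srt) → Setoid {n : ℕ // (σ, n) ∈ V}) (l : List (QF L)),
    (∀ ψ, ψ ∈ l ↔ ∃ (σ : L.Srt) (x y : {n : ℕ // (σ, n) ∈ V}),
      ((E σ) x y ∧ ψ = .eq (.var σ x) (.var σ y)) ∨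
      (¬ (E σ) x y ∧ ψ = .neg (.eq (.var σ x) (.var σ y)))) ∧
    δ = QF.conj l

namespace Theory

variable {L : Signature} (T : Theory.{w} L) (S : Set L.Srt)

/-- Smoothness with respect to the sorts in `S`. -/
def Smooth : Prop :=
  ∀ (φ : QF L) (A : Structure.{w} L) (v : A.Valuation), A ∈ T → A.Sat v φ →
    ∀ κ : S → Cardinal.{w}, (∀ σ : S, Cardinal.mk (A.carrier σ) ≤ κ σ) →
      ∃ (A' : Structure.{w} L) (v' : A'.Valuation), A' ∈ T ∧ A'.Sat v' φ ∧
        ∀ σ : S, Cardinal.mk (A'.carrier σ) = κ σ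

/-- `φ` is satisfied by some interpretation of the theory. -/
def Satisfiable (φ : QF L) : Prop :=
  ∃ (A : Structure.{w} L) (v : A.Valuation), A ∈ T ∧ A.Sat v φ

/-- The interpretation `(A, v)` is a finite witness of `φ`: it belongs to the theory, satisfies `φ`,
and every element of a sort in `S` is the value of a free variable of `φ` of that sort. -/
def IsFiniteWitness (φ : QF L) (A : Structure.{w} L) (v : A.Valuation) : Prop :=
  A ∈ T ∧ A.Sat v φ ∧
    ∀ σ ∈ S, (Set.univ : Set (A.carrier σ)) = {a | ∃ n, (σ, n) ∈ φ.fv ∧ v σ n = a}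

/-- `φ` is unsatisfiable in the theory or has a finite witness. -/
def FinitelyWitnessed (φ : QF L) : Prop :=
  ¬ T.Satisfiable φ ∨ ∃ (A : Structure.{w} L) (v : A.Valuation), T.IsFiniteWitness S φ A v

/-- `φ ∧ δ` is finitely witnessed for every arrangement `δ` of a finite set of variables whose
sorts are in `S`. -/
def StronglyFinitelyWitnessed (φ : QF L) : Prop :=
  ∀ (V : Finset (Var L)) (δ : QF L), (∀ x ∈ V, x.1 ∈ S) → IsArrangement V δ →
    T.FinitelyWitnessed S (.and φ δ)

/-- `wtn` is a strong witness: `φ` is equivalent in the theory to `∃ W. wtn φ`, where `W` are the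
variables of `wtn φ` not in `φ`, and `wtn φ` is strongly finitely witnessed. -/
def IsStrongWitness (wtn : QF L → QF L) : Prop :=
  ∀ φ : QF L,
    (∀ (A : Structure.{w} L) (v : A.Valuation), A ∈ T →
      (A.Sat v φ ↔ A.SatEx v ((wtn φ).fv \ φ.fv) (wtn φ))) ∧
    T.StronglyFinitelyWitnessed S (wtn φ)

/-- There is a computable strong witness. -/
def StronglyFinitelyWitnessable [Encodable L.Srt] [Encodable L.Fn] [Encodable L.Pr] : Prop :=
  ∃ wtn : QF L → QF L, ComputableQF wtn ∧ T.IsStrongWitness S wtn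

/-- Strong politeness with respect to the sorts in `S`. -/
def StronglyPolite [Encodable L.Srt] [Encodable L.Fn] [Encodable L.Pr] : Prop :=
  T.Smooth S ∧ T.StronglyFinitelyWitnessable S

end Theory

/-! ### Datatypes -/

/-- Finitely many element sorts, struct sorts and constructors, with the arities of the
constructors; the result of a constructor is of a struct sort. -/
structure ConstructorSignature where
  Elem : Type
  Struct : Type
  Con : Type
  finiteElem : Finite Elem
  finiteStruct : Finite Struct
  finiteCon : Finite Con
  arity : Con → ℕ
  dom : (c : Con) → Fin (arity c) → Elem ⊕ Struct
  cod : Con → Struct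

/-- The trees of each sort that are built by the constructors from elements of `D`. -/
inductive Tree (C : ConstructorSignature) (D : C.Elem → Type w) :
    C.Elem ⊕ C.Struct → Type w
  | leaf (e : C.Elem) (a : D e) : Tree C D (Sum.inl e)
  | node (c : C.Con) (args : (i : Fin (C.arity c)) → Tree C D (C.dom c i)) :
      Tree C D (Sum.inr (C.cod c))

/-- A datatypes signature: well-foundedness says that every struct sort has a tree, when every
element sort has exactly one element. -/
structure DatatypesSignature extends ConstructorSignature where
  wellFounded : ∀ σ : Struct,
    Nonempty (Tree toConstructorSignature (fun _ => Unit) (Sum.inr σ))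

/-- Replacing the leaves of a tree. -/
def Tree.map {C : ConstructorSignature} {D : C.Elem → Type} {D' : C.Elem → Type w}
    (g : ∀ e, D e → D' e) : {σ : C.Elem ⊕ C.Struct} → Tree C D σ → Tree C D' σ
  | _, .leaf e a => .leaf e (g e a)
  | _, .node c args => .node c fun i => (args i).map g

theorem DatatypesSignature.nonempty_tree (C : DatatypesSignature)
    (D : C.Elem → Type w) (hD : ∀ e, Nonempty (D e)) (σ : C.Elem ⊕ C.Struct) :
    Nonempty (Tree C.toConstructorSignature D σ) := by
  cases σ with
  | inl e => exact (hD e).map (Tree.leaf e)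
  | inr σ => exact (C.wellFounded σ).map (Tree.map fun e _ => (hD e).some)

/-- The first-order signature of a datatypes signature. The function symbols are the constructors
`c` and, for every argument position `i` of `c`, a selector `⟨c, i⟩`; the predicate symbols are the
testers, one for every constructor. -/
def DatatypesSignature.sig (C : DatatypesSignature) : Signature where
  Srt := C.Elem ⊕ C.Struct
  Fn := C.Con ⊕ (c : C.Con) × Fin (C.arity c)
  Pr := C.Con
  fnArity
    | .inl c => C.arity c
    | .inr _ => 1
  fnDom
    | .inl c => C.dom c
    | .inr s => fun _ => .inr (C.cod s.1)
  fnCod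
    | .inl c => .inr (C.cod c)
    | .inr s => C.dom s.1 s.2
  prArity _ := 1
  prDom c _ := .inr (C.cod c)

/-- The set of element sorts. -/
def DatatypesSignature.elemSorts (C : DatatypesSignature) : Set C.sig.Srt :=
  Set.range (Sum.inl : C.Elem → C.Elem ⊕ C.Struct)

/-- The structure of trees over `D`, with `sel c i` as the interpretation of the selectors. -/
def DatatypesSignature.treeStructure (C : DatatypesSignature)
    (D : C.Elem → Type w) (hD : ∀ e, Nonempty (D e))
    (sel : (c : C.Con) → (i : Fin (C.arity c)) →
      Tree C.toConstructorSignature D (Sum.inr (C.cod c)) →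
      Tree C.toConstructorSignature D (C.dom c i)) :
    Structure.{w} C.sig where
  carrier := Tree C.toConstructorSignature D
  nonempty := C.nonempty_tree D hD
  fn
    | .inl c => fun args => Tree.node c args
    | .inr s => fun args => sel s.1 s.2 (args (0 : Fin 1))
  pr c := fun args => ∃ ts, args (0 : Fin 1) = Tree.node c ts

/-- The theory of datatypes: all tree structures over a family `D` of non-empty sets indexed by the
element sorts. A selector is determined on the trees built by its constructor, and arbitrary on the
other trees. -/
def DatatypesSignature.theory (C : DatatypesSignature) : Theory.{w} C.sig :=
  {A | ∃ (D : C.Elem → Type w) (hD : ∀ e, Nonempty (D e))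
      (sel : (c : C.Con) → (i : Fin (C.arity c)) →
        Tree C.toConstructorSignature D (Sum.inr (C.cod c)) →
        Tree C.toConstructorSignature D (C.dom c i)),
      (∀ c i ts, sel c i (Tree.node c ts) = ts i) ∧ A = C.treeStructure D hD sel}

end DT

/-! Smoothness: enlarge the leaf sets along injections. Relabelling leaves is injective on trees and
commutes with constructors, so it preserves literals; on a tree not built by its constructor, a
selector copies its value in the old structure (`exists_transfer`).

Finite witnessability: the obstacle to discarding unnamed elements is a leaf hidden inside the value
of a term. Call a sort bounded if its trees have bounded depth. A subtree of unbounded sort can be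
exchanged for a deep tree over the surviving elements; a subtree of bounded sort leaves no such
freedom. So `wtn φ` closes the subterms of `φ` under the selectors into bounded sorts and equates
each resulting term of an element sort with a fresh variable. The closure is finite because these
selectors lower a rank of sorts (`exists_rank`). One variable of each element sort is thrown in, so
that no element sort becomes empty.

Given a model of `wtn φ ∧ δ`, let `X` be the values of the relevant terms and of the element
variables, `M` a bound on their depths, and `Y` the immediate subtrees of members of `X` that lie
outside `X`; these have unbounded sorts. `exists_fresh` assigns to them trees over the named
elements, of depths above `M` and pairwise more than `M` apart. Substituting them is injective on
`X` by comparison of depths (`Tree.graft_injOn`), so satisfaction transfers (`exists_shrink`).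

Computability: boundedness of sorts and the number of selector rounds depend only on the signature,
hence enter as constants, and all closures are iterations of a length known in advance. -/

namespace DT

/-! ### Closing a list under a generating function -/

section Saturate

variable {α β : Type*}

/-- `k` rounds of adjoining to `l` everything that `ch` generates from its members. -/
def saturate (ch : α → List α) (k : ℕ) (l : List α) : List α :=
  (fun l => l ++ l.flatMap ch)^[k] l

theorem saturate_succ (ch : α → List α) (k : ℕ) (l : List α) :
    saturate ch (k + 1) l = saturate ch k l ++ (saturate ch k l).flatMap ch := by
  simp only [saturate, Function.iterate_succ_apply']

theorem mem_saturate_succ {ch : α → List α} {k : ℕ} {l : List α} {a : α} :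
    a ∈ saturate ch (k + 1) l ↔
      a ∈ saturate ch k l ∨ ∃ b ∈ saturate ch k l, a ∈ ch b := by
  rw [saturate_succ, List.mem_append, List.mem_flatMap]

theorem saturate_mono (ch : α → List α) (l : List α) {j k : ℕ} (h : j ≤ k) {a : α}
    (ha : a ∈ saturate ch j l) : a ∈ saturate ch k l := by
  induction k, h using Nat.le_induction with
  | base => exact ha
  | succ k _ ih => exact mem_saturate_succ.2 (.inl ih)

theorem mem_saturate_of_mem (ch : α → List α) (k : ℕ) {l : List α} {a : α} (ha : a ∈ l) :
    a ∈ saturate ch k l :=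
  saturate_mono ch l (Nat.zero_le k) ha

theorem saturate_induction {ch : α → List α} {l : List α} {P : α → Prop}
    (h0 : ∀ a ∈ l, P a) (hs : ∀ a, P a → ∀ b ∈ ch a, P b) (k : ℕ) :
    ∀ a ∈ saturate ch k l, P a := by
  induction k with
  | zero => exact h0
  | succ k ih =>
    intro a ha
    rcases mem_saturate_succ.1 ha with ha | ⟨b, hb, hab⟩
    · exact ih a ha
    · exact hs b (ih b hb) a hab

/-- If `ch` strictly decreases a rank that is at most `K`, then `K` rounds suffice. -/
theorem saturate_closed {ch : α → List α} {rk : α → ℕ} {K : ℕ} {l : List α}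
    (h0 : ∀ a ∈ l, rk a ≤ K) (hs : ∀ a, ∀ b ∈ ch a, rk b < rk a)
    {a b : α} (ha : a ∈ saturate ch K l) (hb : b ∈ ch a) : b ∈ saturate ch K l := by
  -- Whatever appears in any round has already appeared by round `K - rk a`; later rounds add
  -- nothing.
  have key : ∀ k, ∀ a ∈ saturate ch k l, rk a ≤ K ∧ a ∈ saturate ch (K - rk a) l := by
    intro k
    induction k with
    | zero => exact fun a ha => ⟨h0 a ha, mem_saturate_of_mem ch _ ha⟩
    | succ k ih =>
      intro a ha
      rcases mem_saturate_succ.1 ha with ha | ⟨b, hb, hab⟩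
      · exact ih a ha
      · obtain ⟨h1, h2⟩ := ih b hb
        have h3 := hs b a hab
        exact ⟨by omega, saturate_mono ch l (j := K - rk b + 1) (by omega)
          (mem_saturate_succ.2 (.inr ⟨b, h2, hab⟩))⟩
  exact saturate_mono ch l (Nat.sub_le _ _)
    (key (K + 1) b (mem_saturate_succ.2 (.inr ⟨a, ha, hb⟩))).2

/-- If `ch'` tracks `ch` along `f`, the closures agree round by round; this moves closures of terms
and formulas to their codes. -/
theorem map_saturate {ch : α → List α} {ch' : β → List β} {f : α → β}
    (h : ∀ a, ch' (f a) = (ch a).map f) (k : ℕ) (l : List α) :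
    (saturate ch k l).map f = saturate ch' k (l.map f) := by
  induction k with
  | zero => rfl
  | succ k ih =>
    rw [saturate_succ, saturate_succ, ← ih, List.map_append, List.map_flatMap, List.flatMap_map]
    simp only [h]

theorem primrec_saturate {α : Type*} [Primcodable α] {ch : ℕ → List ℕ} (hch : Primrec ch)
    {k : α → ℕ} (hk : Primrec k) {l : α → List ℕ} (hl : Primrec l) :
    Primrec fun a => saturate ch (k a) (l a) := by
  refine Primrec.nat_iterate (h := fun _ l => l ++ l.flatMap ch) hk hl ?_
  exact Primrec.list_append.comp Primrec.snd
    (Primrec.list_flatMap Primrec.snd (hch.comp Primrec.snd))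

end Saturate

/-! ### Codes -/

/-- Every function on a finite type is tracked by a primitive recursive function on codes. -/
theorem exists_primrec_encode {α : Type*} [Encodable α] [Finite α] (g : α → ℕ) :
    ∃ F : ℕ → ℕ, Primrec F ∧ ∀ a, F (Encodable.encode a) = g a := by
  obtain ⟨N, hN⟩ := (Set.finite_range (Encodable.encode : α → ℕ)).bddAbove
  -- A lookup table up to the largest code; numbers that code nothing get the junk value `0`.
  refine ⟨fun n => ((List.range (N + 1)).map fun m =>
    ((Encodable.decode m : Option α).map g).getD 0).getD n 0,
    (Primrec.list_getD 0).comp (Primrec.const _) Primrec.id, fun a => ?_⟩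
  have : Encodable.encode a < N + 1 := Nat.lt_succ_of_le (hN ⟨a, rfl⟩)
  simp [List.getD, List.getElem?_map, List.getElem?_range this]

/-- A term with its sort. -/
abbrev STerm (L : Signature) : Type := Σ σ, Term L σ

variable {L : Signature}

/-- The immediate subterms. -/
def STerm.args : STerm L → List (STerm L)
  | ⟨_, .var _ _⟩ => []
  | ⟨_, .app _ args⟩ => List.ofFn fun i => ⟨_, args i⟩

/-- The immediate subformulas. -/
def QF.children : QF L → List (QF L)
  | .neg φ => [φ]
  | .and φ ψ => [φ, ψ]
  | .or φ ψ => [φ, ψ]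
  | _ => []

/-- The terms that an atomic formula is about. -/
def QF.atomTerms : QF L → List (STerm L)
  | .eq t u => [⟨_, t⟩, ⟨_, u⟩]
  | .pred _ args => List.ofFn fun i => ⟨_, args i⟩
  | _ => []

theorem le_encode_of_mem {l : List ℕ} {a : ℕ} (h : a ∈ l) : a ≤ Encodable.encode l := by
  induction l with
  | nil => simp at h
  | cons b l ih =>
    rw [Encodable.encode_list_cons]
    rcases List.mem_cons.1 h with rfl | h
    · exact (Nat.left_le_pair a _).trans (Nat.le_succ _)
    · exact (ih h).trans ((Nat.right_le_pair _ _).trans (Nat.le_succ _))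

/-- Nonzero tags make a code exceed what it tags, so codes can serve as ranks for passing to
subterms and subformulas. -/
theorem lt_pair_of_pos {k n : ℕ} (hk : 0 < k) : n < Nat.pair k n := by
  unfold Nat.pair
  split_ifs <;> nlinarith

section Code

variable [Encodable L.Srt] [Encodable L.Fn]

/-- The code of a term with a sort. -/
def STerm.code (r : STerm L) : ℕ := r.2.code

/-- The tag separates variables from applications, and the head symbol determines the sort. Needed
so that distinct terms receive distinct names. -/
theorem STerm.code_injective : Function.Injective (STerm.code (L := L)) := by
  rintro ⟨σ, t⟩
  induction t with
  | var σ n =>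
    rintro ⟨_, u⟩ h
    cases u with
    | var τ m =>
      simp only [code, Term.code, Nat.pair_eq_pair, Encodable.encode_inj, true_and] at h
      obtain ⟨rfl, rfl⟩ := h
      rfl
    | app g us => simp [code, Term.code] at h
  | app f ts ih =>
    rintro ⟨_, u⟩ h
    cases u with
    | var τ m => simp [code, Term.code] at h
    | app g us =>
      simp only [code, Term.code, Nat.pair_eq_pair, Encodable.encode_inj, true_and] at h
      obtain ⟨rfl, h⟩ := h
      have h := List.ofFn_injective h
      have : ts = us := funext fun i => by
        have := ih i (a₂ := ⟨_, us i⟩) (congrFun h i)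
        simpa using this
      rw [this]

theorem STerm.code_lt_of_mem_args {r s : STerm L} (h : s ∈ r.args) : s.code < r.code := by
  obtain ⟨_, t⟩ := r
  cases t with
  | var => simp [args] at h
  | app f ts =>
    obtain ⟨i, rfl⟩ := List.mem_ofFn.1 h
    have : (ts i).code ∈ List.ofFn fun i => (ts i).code := List.mem_ofFn.2 ⟨i, rfl⟩
    exact ((le_encode_of_mem this).trans (Nat.right_le_pair _ _)).trans_lt
      (lt_pair_of_pos one_pos)

theorem Term.le_code_of_mem_vars {σ τ : L.Srt} {t : Term L σ} {n : ℕ} (h : (τ, n) ∈ t.vars) :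
    n ≤ t.code := by
  induction t with
  | var σ m =>
    obtain ⟨rfl, rfl⟩ := Prod.mk.inj (Set.mem_singleton_iff.1 h)
    exact (Nat.right_le_pair _ _).trans (Nat.right_le_pair _ _)
  | app f ts ih =>
    obtain ⟨i, hi⟩ := Set.mem_iUnion.1 h
    refine (ih i hi).trans (STerm.code_lt_of_mem_args (r := ⟨_, .app f ts⟩) (s := ⟨_, ts i⟩) ?_).le
    exact List.mem_ofFn.2 ⟨i, rfl⟩

variable [Encodable L.Pr]

theorem QF.code_lt_of_mem_children {φ ψ : QF L} (h : ψ ∈ φ.children) : ψ.code < φ.code := by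
  cases φ with
  | neg φ =>
    obtain rfl := List.mem_singleton.1 h
    exact lt_pair_of_pos (by norm_num)
  | and φ₁ φ₂ =>
    refine lt_of_le_of_lt ?_ (lt_pair_of_pos (by norm_num : 0 < 4))
    rcases List.mem_cons.1 h with rfl | h
    · exact Nat.left_le_pair _ _
    · obtain rfl := List.mem_singleton.1 h
      exact Nat.right_le_pair _ _
  | or φ₁ φ₂ =>
    refine lt_of_le_of_lt ?_ (lt_pair_of_pos (by norm_num : 0 < 5))
    rcases List.mem_cons.1 h with rfl | h
    · exact Nat.left_le_pair _ _
    · obtain rfl := List.mem_singleton.1 h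
      exact Nat.right_le_pair _ _
  | _ => simp [children] at h

theorem QF.code_le_of_mem_atomTerms {φ : QF L} {r : STerm L} (h : r ∈ φ.atomTerms) :
    r.code ≤ φ.code := by
  cases φ with
  | eq t u =>
    refine le_trans ?_ (Nat.right_le_pair _ _)
    rcases List.mem_cons.1 h with rfl | h
    · exact Nat.left_le_pair _ _
    · obtain rfl := List.mem_singleton.1 h
      exact Nat.right_le_pair _ _
  | pred p ts =>
    obtain ⟨i, rfl⟩ := List.mem_ofFn.1 h
    have : (ts i).code ∈ List.ofFn fun i => (ts i).code := List.mem_ofFn.2 ⟨i, rfl⟩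
    exact ((le_encode_of_mem this).trans (Nat.right_le_pair _ _)).trans (Nat.right_le_pair _ _)
  | _ => simp [atomTerms] at h

/-- Hence every variable of index above `φ.code` is fresh for `φ`. -/
theorem QF.le_code_of_mem_fv {σ : L.Srt} {φ : QF L} {n : ℕ} (h : (σ, n) ∈ φ.fv) :
    n ≤ φ.code := by
  induction φ with
  | falsum => exact h.elim
  | eq t u =>
    rcases h with h | h
    · exact (Term.le_code_of_mem_vars h).trans
        (code_le_of_mem_atomTerms (φ := .eq t u) (r := ⟨_, t⟩) (by simp [atomTerms]))
    · exact (Term.le_code_of_mem_vars h).trans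
        (code_le_of_mem_atomTerms (φ := .eq t u) (r := ⟨_, u⟩) (by simp [atomTerms]))
  | pred p ts =>
    obtain ⟨i, hi⟩ := Set.mem_iUnion.1 h
    exact (Term.le_code_of_mem_vars hi).trans (code_le_of_mem_atomTerms (φ := .pred p ts)
      (r := ⟨_, ts i⟩) (List.mem_ofFn.2 ⟨i, rfl⟩))
  | neg φ ih => exact (ih h).trans (code_lt_of_mem_children (φ := .neg φ) (by simp [children])).le
  | and φ ψ ih₁ ih₂ =>
    rcases h with h | h
    · exact (ih₁ h).trans (code_lt_of_mem_children (φ := .and φ ψ) (by simp [children])).le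
    · exact (ih₂ h).trans (code_lt_of_mem_children (φ := .and φ ψ) (by simp [children])).le
  | or φ ψ ih₁ ih₂ =>
    rcases h with h | h
    · exact (ih₁ h).trans (code_lt_of_mem_children (φ := .or φ ψ) (by simp [children])).le
    · exact (ih₂ h).trans (code_lt_of_mem_children (φ := .or φ ψ) (by simp [children])).le

end Code

/-! ### Tracking the syntactic operations on codes -/

/-- The list with a given code. -/
def decodeList (n : ℕ) : List ℕ := (Encodable.decode n : Option (List ℕ)).getD []

@[simp] theorem decodeList_encode (l : List ℕ) : decodeList (Encodable.encode l) = l := by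
  simp [decodeList]

theorem primrec_decodeList : Primrec decodeList :=
  Primrec.option_getD.comp Primrec.decode (Primrec.const [])

/-- `STerm.args` on codes. -/
def argsCode (n : ℕ) : List ℕ :=
  if n.unpair.1 = 1 then decodeList n.unpair.2.unpair.2 else []

/-- `QF.children` on codes. -/
def childrenCode (n : ℕ) : List ℕ :=
  if n.unpair.1 = 3 then [n.unpair.2]
  else if 4 ≤ n.unpair.1 then [n.unpair.2.unpair.1, n.unpair.2.unpair.2] else []

/-- `QF.atomTerms` on codes. -/
def atomTermsCode (n : ℕ) : List ℕ :=
  if n.unpair.1 = 1 then [n.unpair.2.unpair.1, n.unpair.2.unpair.2]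
  else if n.unpair.1 = 2 then decodeList n.unpair.2.unpair.2 else []

/-- `QF.conj` on codes. -/
def conjCode (l : List ℕ) : ℕ :=
  l.foldr (fun a b => Nat.pair 4 (Nat.pair a b)) (Nat.pair 3 (Nat.pair 0 0))

/-- The code of the sort of a term, computed from the code of the term; `F` tracks `fnCod`. -/
def sortCode (F : ℕ → ℕ) (n : ℕ) : ℕ :=
  if n.unpair.1 = 0 then n.unpair.2.unpair.1 else F n.unpair.2.unpair.1

section Primrec

open _root_.Primrec

theorem primrec_unpair₁ : Primrec fun n : ℕ => n.unpair.1 := fst.comp unpair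
theorem primrec_unpair₂ : Primrec fun n : ℕ => n.unpair.2 := snd.comp unpair
theorem primrec_unpair₂₁ : Primrec fun n : ℕ => n.unpair.2.unpair.1 :=
  primrec_unpair₁.comp primrec_unpair₂
theorem primrec_unpair₂₂ : Primrec fun n : ℕ => n.unpair.2.unpair.2 :=
  primrec_unpair₂.comp primrec_unpair₂

theorem primrec_list_pair {α : Type*} [Primcodable α] {f g : α → ℕ} (hf : Primrec f)
    (hg : Primrec g) : Primrec fun a => [f a, g a] :=
  list_cons.comp hf (list_cons.comp hg (const []))

theorem primrec_argsCode : Primrec argsCode :=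
  ite (Primrec.eq.comp primrec_unpair₁ (const 1)) (primrec_decodeList.comp primrec_unpair₂₂)
    (const [])

theorem primrec_childrenCode : Primrec childrenCode :=
  ite (Primrec.eq.comp primrec_unpair₁ (const 3)) (list_cons.comp primrec_unpair₂ (const []))
    (ite (nat_le.comp (const 4) primrec_unpair₁)
      (primrec_list_pair primrec_unpair₂₁ primrec_unpair₂₂) (const []))

theorem primrec_atomTermsCode : Primrec atomTermsCode :=
  ite (Primrec.eq.comp primrec_unpair₁ (const 1))
    (primrec_list_pair primrec_unpair₂₁ primrec_unpair₂₂)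
    (ite (Primrec.eq.comp primrec_unpair₁ (const 2)) (primrec_decodeList.comp primrec_unpair₂₂)
      (const []))

theorem primrec_conjCode : Primrec conjCode :=
  list_foldr (h := fun _ p => Nat.pair 4 (Nat.pair p.1 p.2)) Primrec.id (const _)
    (Primrec₂.natPair.comp (const 4)
      (Primrec₂.natPair.comp (fst.comp snd) (snd.comp snd)))

theorem primrec_sortCode {F : ℕ → ℕ} (hF : Primrec F) : Primrec (sortCode F) :=
  ite (Primrec.eq.comp primrec_unpair₁ (const 0)) primrec_unpair₂₁ (hF.comp primrec_unpair₂₁)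

end Primrec

section Track

variable [Encodable L.Srt] [Encodable L.Fn]

theorem argsCode_code (r : STerm L) : argsCode r.code = r.args.map STerm.code := by
  obtain ⟨_, t⟩ := r
  cases t <;> simp [argsCode, STerm.code, Term.code, STerm.args, List.map_ofFn, Function.comp_def]

theorem sortCode_code {F : ℕ → ℕ} (hF : ∀ f : L.Fn, F (Encodable.encode f) =
    Encodable.encode (L.fnCod f)) (r : STerm L) : sortCode F r.code = Encodable.encode r.1 := by
  obtain ⟨_, t⟩ := r
  cases t <;> simp [sortCode, STerm.code, Term.code, hF]

variable [Encodable L.Pr]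

theorem childrenCode_code (φ : QF L) : childrenCode φ.code = φ.children.map QF.code := by
  cases φ <;> simp [childrenCode, QF.code, QF.children]

theorem atomTermsCode_code (φ : QF L) : atomTermsCode φ.code = φ.atomTerms.map STerm.code := by
  cases φ <;>
    simp [atomTermsCode, QF.code, QF.atomTerms, STerm.code, List.map_ofFn, Function.comp_def]

theorem conjCode_code (l : List (QF L)) : conjCode (l.map QF.code) = (QF.conj l).code := by
  induction l with
  | nil => simp [conjCode, QF.conj, QF.code]
  | cons φ l ih =>
    rw [QF.conj, QF.code, ← ih]
    simp [conjCode]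

end Track

/-! ### The subterms of a formula -/

section Subterms

variable [Encodable L.Srt] [Encodable L.Fn] [Encodable L.Pr]

/-- The terms of the atomic subformulas of `φ`. -/
def QF.topTerms (φ : QF L) : List (STerm L) :=
  (saturate QF.children φ.code [φ]).flatMap QF.atomTerms

/-- `QF.topTerms` on codes. -/
def topTermsCode (n : ℕ) : List ℕ :=
  (saturate childrenCode n [n]).flatMap atomTermsCode

theorem primrec_topTermsCode : Primrec topTermsCode :=
  Primrec.list_flatMap (primrec_saturate primrec_childrenCode Primrec.id
    (Primrec.list_cons.comp Primrec.id (Primrec.const []))) (primrec_atomTermsCode.comp Primrec.snd)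

theorem topTermsCode_code (φ : QF L) : topTermsCode φ.code = φ.topTerms.map STerm.code := by
  rw [topTermsCode, QF.topTerms, List.map_flatMap,
    ← List.map_singleton (f := QF.code) (a := φ), ← map_saturate childrenCode_code,
    List.flatMap_map]
  simp only [atomTermsCode_code]

theorem QF.code_le_of_mem_topTerms {φ : QF L} {r : STerm L} (h : r ∈ φ.topTerms) :
    r.code ≤ φ.code := by
  obtain ⟨ψ, hψ, hr⟩ := List.mem_flatMap.1 h
  refine (code_le_of_mem_atomTerms hr).trans ?_
  refine saturate_induction (P := fun ψ : QF L => ψ.code ≤ φ.code) (by simp) ?_ _ ψ hψ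
  exact fun a ha b hb => (code_lt_of_mem_children hb).le.trans ha

/-- All terms of the atomic subformulas belong to `R`. -/
def QF.TermsIn (R : Set (STerm L)) : QF L → Prop
  | .falsum => True
  | .eq t u => ⟨_, t⟩ ∈ R ∧ ⟨_, u⟩ ∈ R
  | .pred _ args => ∀ i, ⟨_, args i⟩ ∈ R
  | .neg φ => φ.TermsIn R
  | .and φ ψ => φ.TermsIn R ∧ ψ.TermsIn R
  | .or φ ψ => φ.TermsIn R ∧ ψ.TermsIn R

/-- Codes drop strictly from a formula to its immediate subformulas, so `φ.code` rounds reach all of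
them. -/
theorem QF.termsIn_topTerms (φ : QF L) : φ.TermsIn {r | r ∈ φ.topTerms} := by
  have closed : ∀ {ψ χ : QF L}, ψ ∈ saturate QF.children φ.code [φ] → χ ∈ ψ.children →
      χ ∈ saturate QF.children φ.code [φ] := fun hψ hχ =>
    saturate_closed (rk := QF.code) (by simp) (fun _ _ => code_lt_of_mem_children) hψ hχ
  have key : ∀ ψ : QF L, ψ ∈ saturate QF.children φ.code [φ] →
      ψ.TermsIn {r | r ∈ φ.topTerms} := by
    intro ψ
    induction ψ with
    | falsum => exact fun _ => trivial
    | eq t u =>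
      exact fun h => ⟨List.mem_flatMap.2 ⟨_, h, by simp [atomTerms]⟩,
        List.mem_flatMap.2 ⟨_, h, by simp [atomTerms]⟩⟩
    | pred p ts =>
      exact fun h i => List.mem_flatMap.2 ⟨_, h, List.mem_ofFn.2 ⟨i, rfl⟩⟩
    | neg ψ ih => exact fun h => ih (closed h (by simp [children]))
    | and ψ χ ih₁ ih₂ =>
      exact fun h => ⟨ih₁ (closed h (by simp [children])), ih₂ (closed h (by simp [children]))⟩
    | or ψ χ ih₁ ih₂ =>
      exact fun h => ⟨ih₁ (closed h (by simp [children])), ih₂ (closed h (by simp [children]))⟩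
  exact key φ (mem_saturate_of_mem _ _ (by simp))

end Subterms

/-! ### Conjunctions, free variables and the coincidence lemma -/

theorem QF.TermsIn.mono {R R' : Set (STerm L)} (h : R ⊆ R') {φ : QF L} (hφ : φ.TermsIn R) :
    φ.TermsIn R' := by
  induction φ with
  | falsum => trivial
  | eq t u => exact ⟨h hφ.1, h hφ.2⟩
  | pred p ts => exact fun i => h (hφ i)
  | neg φ ih => exact ih hφ
  | and φ ψ ih₁ ih₂ => exact ⟨ih₁ hφ.1, ih₂ hφ.2⟩
  | or φ ψ ih₁ ih₂ => exact ⟨ih₁ hφ.1, ih₂ hφ.2⟩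

theorem QF.termsIn_conj {R : Set (STerm L)} {l : List (QF L)} :
    (QF.conj l).TermsIn R ↔ ∀ φ ∈ l, φ.TermsIn R := by
  induction l with
  | nil => simp [conj, TermsIn]
  | cons φ l ih => simp [conj, TermsIn, ih]

theorem QF.mem_fv_conj {l : List (QF L)} {x : Var L} :
    x ∈ (QF.conj l).fv ↔ ∃ φ ∈ l, x ∈ φ.fv := by
  induction l with
  | nil => simp [conj, fv]
  | cons φ l ih => simp [conj, fv, ih]

theorem Structure.sat_conj {A : Structure.{w} L} {v : A.Valuation} {l : List (QF L)} :
    A.Sat v (QF.conj l) ↔ ∀ φ ∈ l, A.Sat v φ := by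
  induction l with
  | nil => simp [QF.conj, Sat]
  | cons φ l ih => simp [QF.conj, Sat, ih]

theorem Term.finite_vars {σ : L.Srt} (t : Term L σ) : t.vars.Finite := by
  induction t with
  | var σ n => exact Set.finite_singleton _
  | app f ts ih => exact Set.finite_iUnion ih

theorem QF.finite_fv (φ : QF L) : φ.fv.Finite := by
  induction φ with
  | falsum => exact Set.finite_empty
  | eq t u => exact t.finite_vars.union u.finite_vars
  | pred p ts => exact Set.finite_iUnion fun i => (ts i).finite_vars
  | neg φ ih => exact ih
  | and φ ψ ih₁ ih₂ => exact ih₁.union ih₂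
  | or φ ψ ih₁ ih₂ => exact ih₁.union ih₂

theorem Structure.eval_congr {A : Structure.{w} L} {v v' : A.Valuation} {σ : L.Srt}
    {t : Term L σ} (h : ∀ τ n, (τ, n) ∈ t.vars → v τ n = v' τ n) : A.eval v t = A.eval v' t := by
  induction t with
  | var σ n => exact h σ n rfl
  | app f ts ih =>
    simp only [eval]
    congr 1
    exact funext fun i => ih i fun τ n hn => h τ n (Set.mem_iUnion.2 ⟨i, hn⟩)

theorem Structure.sat_congr {A : Structure.{w} L} {v v' : A.Valuation} {φ : QF L}
    (h : ∀ τ n, (τ, n) ∈ φ.fv → v τ n = v' τ n) : A.Sat v φ ↔ A.Sat v' φ := by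
  induction φ with
  | falsum => rfl
  | eq t u =>
    simp only [Sat]
    rw [eval_congr fun τ n hn => h τ n (.inl hn), eval_congr fun τ n hn => h τ n (.inr hn)]
  | pred p ts =>
    simp only [Sat]
    rw [show (fun i => A.eval v (ts i)) = fun i => A.eval v' (ts i) from
      funext fun i => eval_congr fun τ n hn => h τ n (Set.mem_iUnion.2 ⟨i, hn⟩)]
  | neg φ ih => exact not_congr (ih h)
  | and φ ψ ih₁ ih₂ =>
    exact and_congr (ih₁ fun τ n hn => h τ n (.inl hn)) (ih₂ fun τ n hn => h τ n (.inr hn))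
  | or φ ψ ih₁ ih₂ =>
    exact or_congr (ih₁ fun τ n hn => h τ n (.inl hn)) (ih₂ fun τ n hn => h τ n (.inr hn))

/-! ### Trees -/

section Tree

universe u

variable {C : ConstructorSignature} {D : C.Elem → Type u} {D' : C.Elem → Type w}

/-- The constructor at the root. -/
def Tree.head : {σ : C.Elem ⊕ C.Struct} → Tree C D σ → Option C.Con
  | _, .leaf _ _ => none
  | _, .node c _ => some c

theorem Tree.head_eq_some {c : C.Con} {t : Tree C D (.inr (C.cod c))} :
    t.head = some c ↔ ∃ ts, t = .node c ts := by
  refine ⟨?_, by rintro ⟨ts, rfl⟩; rfl⟩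
  -- The sort is generalized because case analysis cannot solve `C.cod d = C.cod c`: several
  -- constructors may share a result sort.
  suffices ∀ σ (t : Tree C D σ) (h : σ = .inr (C.cod c)), t.head = some c →
      ∃ ts, h ▸ t = Tree.node c ts from this _ t rfl
  intro σ t h ht
  cases t with
  | leaf e a => simp [head] at ht
  | node d ts =>
    obtain rfl : d = c := by simpa [head] using ht
    exact ⟨ts, rfl⟩

theorem Tree.exists_leaf {e : C.Elem} (t : Tree C D (.inl e)) : ∃ a, t = .leaf e a := by
  cases t with
  | leaf _ a => exact ⟨a, rfl⟩

/-- The trees of an element sort are the elements. -/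
noncomputable def Tree.leafEquiv (e : C.Elem) : D e ≃ Tree C D (.inl e) :=
  Equiv.ofBijective (Tree.leaf e)
    ⟨fun _ _ h => by simpa using h, fun t => t.exists_leaf.imp fun _ h => h.symm⟩

/-- The depth of a tree; leaves and constants have depth `0` and `1`, respectively. -/
def Tree.depth : {σ : C.Elem ⊕ C.Struct} → Tree C D σ → ℕ
  | _, .leaf _ _ => 0
  | _, .node _ ts => (Finset.univ.sup fun i => (ts i).depth) + 1

theorem Tree.depth_lt {c : C.Con} (ts : ∀ i, Tree C D (C.dom c i)) (i : Fin (C.arity c)) :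
    (ts i).depth < (Tree.node c ts).depth :=
  Nat.lt_succ_of_le (Finset.le_sup (f := fun i => (ts i).depth) (Finset.mem_univ i))

theorem Tree.exists_depth_node {c : C.Con} (ts : ∀ i, Tree C D (C.dom c i)) :
    (Tree.node c ts).depth = 1 ∨ ∃ i, (Tree.node c ts).depth = (ts i).depth + 1 := by
  rcases (Finset.univ : Finset (Fin (C.arity c))).eq_empty_or_nonempty with h | h
  · exact .inl (by simp [depth, h])
  · obtain ⟨i, -, hi⟩ := Finset.exists_mem_eq_sup _ h fun i => (ts i).depth
    exact .inr ⟨i, by rw [depth, hi]⟩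

/-- Replacing the leaves, in any universe. -/
def Tree.mapLeaves (g : ∀ e, D e → D' e) : {σ : C.Elem ⊕ C.Struct} → Tree C D σ → Tree C D' σ
  | _, .leaf e a => .leaf e (g e a)
  | _, .node c ts => .node c fun i => (ts i).mapLeaves g

theorem Tree.depth_mapLeaves (g : ∀ e, D e → D' e) {σ : C.Elem ⊕ C.Struct} (t : Tree C D σ) :
    (t.mapLeaves g).depth = t.depth := by
  induction t with
  | leaf e a => rfl
  | node c ts ih => simp only [mapLeaves, depth, ih]

theorem Tree.head_mapLeaves (g : ∀ e, D e → D' e) {σ : C.Elem ⊕ C.Struct} (t : Tree C D σ) :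
    (t.mapLeaves g).head = t.head := by
  cases t <;> rfl

theorem Tree.mapLeaves_injective {g : ∀ e, D e → D' e} (hg : ∀ e, Function.Injective (g e))
    {σ : C.Elem ⊕ C.Struct} :
    Function.Injective (Tree.mapLeaves g : Tree C D σ → Tree C D' σ) := by
  intro t
  induction t with
  | leaf e a =>
    intro u h
    obtain ⟨b, rfl⟩ := u.exists_leaf
    simp only [mapLeaves, leaf.injEq] at h
    rw [hg e h]
  | node c ts ih =>
    intro u h
    obtain ⟨us, rfl⟩ : ∃ us, u = .node c us := by
      rw [← head_eq_some, ← head_mapLeaves g u, ← h]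
      rfl
    simp only [mapLeaves, node.injEq] at h
    congr 1
    exact funext fun i => ih i (congrFun h i)

end Tree

/-! ### Transferring satisfaction between tree structures -/

variable {C : DatatypesSignature} {D D' : C.Elem → Type w}

/-- The selectors on the trees over `D'` that are induced by selectors on the trees over `D` and a
map `h` of trees, given a set `X` of trees on which `h` is to be a homomorphism. -/
noncomputable def DatatypesSignature.inducedSel (hD' : ∀ e, Nonempty (D' e))
    (sel : (c : C.Con) → (i : Fin (C.arity c)) → Tree C.toConstructorSignature D (.inr (C.cod c)) →
      Tree C.toConstructorSignature D (C.dom c i))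
    (X : ∀ σ, Set (Tree C.toConstructorSignature D σ))
    (h : ∀ σ, Tree C.toConstructorSignature D σ → Tree C.toConstructorSignature D' σ)
    (c : C.Con) (i : Fin (C.arity c)) (t : Tree C.toConstructorSignature D' (.inr (C.cod c))) :
    Tree C.toConstructorSignature D' (C.dom c i) := by
  classical exact
  if ht : ∃ ts, t = .node c ts then ht.choose i
  else if hs : ∃ s ∈ X _, h _ s = t then h _ (sel c i hs.choose)
  else (C.nonempty_tree D' hD' _).some

theorem DatatypesSignature.inducedSel_node {hD' : ∀ e, Nonempty (D' e)}
    {sel : (c : C.Con) → (i : Fin (C.arity c)) → Tree C.toConstructorSignature D (.inr (C.cod c)) →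
      Tree C.toConstructorSignature D (C.dom c i)}
    {X : ∀ σ, Set (Tree C.toConstructorSignature D σ)}
    {h : ∀ σ, Tree C.toConstructorSignature D σ → Tree C.toConstructorSignature D' σ}
    (c : C.Con) (i : Fin (C.arity c)) (ts) :
    C.inducedSel hD' sel X h c i (.node c ts) = ts i := by
  have ht : ∃ us, Tree.node (D := D') c ts = .node c us := ⟨ts, rfl⟩
  exact (dif_pos ht).trans (congrFun (Tree.node.inj ht.choose_spec).symm i)

/-- If `h` is injective on the values of the terms in `R`, and commutes with the constructors
there, then it transfers the satisfaction of all formulas whose terms are in `R`. -/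
theorem DatatypesSignature.exists_transfer {hD : ∀ e, Nonempty (D e)}
    (hD' : ∀ e, Nonempty (D' e))
    {sel : (c : C.Con) → (i : Fin (C.arity c)) → Tree C.toConstructorSignature D (.inr (C.cod c)) →
      Tree C.toConstructorSignature D (C.dom c i)}
    (hsel : ∀ c i ts, sel c i (.node c ts) = ts i)
    (v : (C.treeStructure D hD sel).Valuation)
    (h : ∀ σ, Tree C.toConstructorSignature D σ → Tree C.toConstructorSignature D' σ)
    (R : Set (STerm C.sig)) (hR : ∀ r ∈ R, ∀ s ∈ r.args, s ∈ R)
    (X : ∀ σ, Set (Tree C.toConstructorSignature D σ))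
    (hX : ∀ r ∈ R, (C.treeStructure D hD sel).eval v r.2 ∈ X r.1)
    (hinj : ∀ σ, Set.InjOn (h σ) (X σ))
    (hnode : ∀ c ts, Tree.node c ts ∈ X (.inr (C.cod c)) →
      h _ (.node c ts) = .node c fun i => h _ (ts i)) :
    ∃ sel' : (c : C.Con) → (i : Fin (C.arity c)) →
        Tree C.toConstructorSignature D' (.inr (C.cod c)) →
        Tree C.toConstructorSignature D' (C.dom c i),
      (∀ c i ts, sel' c i (.node c ts) = ts i) ∧
      ∀ φ : QF C.sig, φ.TermsIn R →
        ((C.treeStructure D' hD' sel').Sat (fun σ n => h σ (v σ n)) φ ↔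
          (C.treeStructure D hD sel).Sat v φ) := by
  -- Preserving root constructors settles the testers and tells where a selector is determined.
  have hhead : ∀ c, ∀ t ∈ X (.inr (C.cod c)), (h _ t).head = t.head := by
    intro c
    suffices ∀ σ, σ = .inr (C.cod c) → ∀ t ∈ X σ, (h σ t).head = t.head from this _ rfl
    intro σ hσ t ht
    cases t with
    | leaf e a => simp at hσ
    | node d ts =>
      rw [hnode d ts ht]
      rfl
  refine ⟨C.inducedSel hD' sel X h, C.inducedSel_node, ?_⟩
  suffices ∀ v' : (C.treeStructure D' hD' (C.inducedSel hD' sel X h)).Valuation,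
      (∀ σ n, v' σ n = h σ (v σ n)) → ∀ φ : QF C.sig, φ.TermsIn R →
        ((C.treeStructure D' hD' (C.inducedSel hD' sel X h)).Sat v' φ ↔
          (C.treeStructure D hD sel).Sat v φ) from this _ fun _ _ => rfl
  intro v' hv'
  have heval : ∀ {σ : C.sig.Srt} (t : Term C.sig σ), (⟨σ, t⟩ : STerm C.sig) ∈ R →
      (C.treeStructure D' hD' (C.inducedSel hD' sel X h)).eval v' t =
        h σ ((C.treeStructure D hD sel).eval v t) := by
    intro σ t
    induction t with
    | var σ n => exact fun _ => hv' σ n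
    | app f ts ih =>
      intro ht
      have hts : ∀ i, (⟨_, ts i⟩ : STerm C.sig) ∈ R := fun i =>
        hR _ ht _ (List.mem_ofFn.2 ⟨i, rfl⟩)
      have ih := fun i => ih i (hts i)
      cases f with
      | inl c =>
        exact (congrArg (Tree.node c) (funext ih)).trans (hnode c _ (hX _ ht)).symm
      | inr s =>
        obtain ⟨c, i⟩ := s
        -- If `x` is built by `c`, both sides are its grafted or relabelled `i`-th argument.
        -- Otherwise the preimage of `h x` chosen in `inducedSel` is `x` itself, by injectivity on
        -- `X`.
        have key : ∀ x ∈ X (.inr (C.cod c)),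
            C.inducedSel hD' sel X h c i (h _ x) = h _ (sel c i x) := by
          intro x hx
          by_cases hc : x.head = some c
          · obtain ⟨us, rfl⟩ := Tree.head_eq_some.1 hc
            rw [hnode c us hx, C.inducedSel_node, hsel]
          · have h1 : ¬ ∃ us, h (.inr (C.cod c)) x = .node c us := by
              rwa [← Tree.head_eq_some, hhead c x hx]
            have h2 : ∃ y ∈ X (.inr (C.cod c)), h _ y = h _ x := ⟨x, hx, rfl⟩
            rw [inducedSel, dif_neg h1, dif_pos h2,
              hinj _ h2.choose_spec.1 hx h2.choose_spec.2]
        exact (congrArg (C.inducedSel hD' sel X h c i) (ih (0 : Fin 1))).trans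
          (key _ (hX _ (hts (0 : Fin 1))))
  intro φ
  induction φ with
  | falsum => exact fun _ => Iff.rfl
  | eq t u =>
    rintro ⟨ht, hu⟩
    simp only [Structure.Sat]
    rw [heval t ht, heval u hu]
    exact (hinj _).eq_iff (hX _ ht) (hX _ hu)
  | pred c ts =>
    intro hts
    have key : ∀ c : C.Con, ∀ x ∈ X (.inr (C.cod c)), ∀ y, y = h _ x →
        ((∃ us, y = Tree.node c us) ↔ ∃ us, x = Tree.node c us) := by
      rintro c x hx _ rfl
      rw [← Tree.head_eq_some, ← Tree.head_eq_some, hhead c x hx]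
    exact key c _ (hX _ (hts (0 : Fin 1))) _ (heval _ (hts (0 : Fin 1)))
  | neg φ ih => exact fun hφ => not_congr (ih hφ)
  | and φ ψ ih₁ ih₂ => exact fun hφ => and_congr (ih₁ hφ.1) (ih₂ hφ.2)
  | or φ ψ ih₁ ih₂ => exact fun hφ => or_congr (ih₁ hφ.1) (ih₂ hφ.2)

/-! ### Smoothness -/

theorem QF.termsIn_univ {L : Signature} (φ : QF L) : φ.TermsIn Set.univ := by
  induction φ <;> simp_all [TermsIn]

/-- An injective relabelling of leaves is a homomorphism for constructors on all trees, so the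
transfer applies with every term in `R` and every tree in `X`. -/
theorem DatatypesSignature.smooth_theory (C : DatatypesSignature) :
    Theory.Smooth (theory.{w} C) C.elemSorts := by
  rintro φ A v ⟨D, hD, sel, hsel, rfl⟩ hφ κ hκ
  let D' : C.Elem → Type w := fun e => (κ ⟨.inl e, e, rfl⟩).out
  have hemb : ∀ e, Nonempty (D e ↪ D' e) := fun e => by
    rw [← Cardinal.le_def, Cardinal.mk_out]
    exact (Cardinal.mk_congr (Tree.leafEquiv e)).trans_le (hκ ⟨.inl e, e, rfl⟩)
  let g : ∀ e, D e → D' e := fun e => (hemb e).some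
  have hD' : ∀ e, Nonempty (D' e) := fun e => (hD e).map (g e)
  obtain ⟨sel', hsel', H⟩ := C.exists_transfer hD' hsel v (fun σ => Tree.mapLeaves g) Set.univ
    (fun _ _ _ _ => trivial) (fun _ => Set.univ) (fun _ _ => trivial)
    (fun σ => (Tree.mapLeaves_injective fun e => (hemb e).some.injective).injOn)
    (fun _ _ _ => rfl)
  refine ⟨_, _, ⟨D', hD', sel', hsel', rfl⟩, (H φ φ.termsIn_univ).2 hφ, ?_⟩
  rintro ⟨_, e, rfl⟩
  exact (Cardinal.mk_congr (Tree.leafEquiv e)).symm.trans (Cardinal.mk_out _)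

/-! ### Sorts of bounded depth -/

section Bounded

variable (C : DatatypesSignature)

/-- The trees of sort `σ` have bounded depth (which does not depend on the elements). -/
def DatatypesSignature.Bounded (σ : C.Elem ⊕ C.Struct) : Prop :=
  ∃ N, ∀ t : Tree C.toConstructorSignature (fun _ => Unit) σ, t.depth ≤ N

variable {C}

theorem DatatypesSignature.bounded_inl (e : C.Elem) : C.Bounded (.inl e) :=
  ⟨0, fun t => by obtain ⟨a, rfl⟩ := t.exists_leaf; exact le_rfl⟩

/-- Relabelling leaves keeps the depth, so deep trees over one-point sets give deep trees over any
`D`. -/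
theorem DatatypesSignature.exists_depth_gt {σ : C.Elem ⊕ C.Struct} (h : ¬ C.Bounded σ)
    {D : C.Elem → Type w} (hD : ∀ e, Nonempty (D e)) (N : ℕ) :
    ∃ t : Tree C.toConstructorSignature D σ, N < t.depth := by
  simp only [Bounded, not_exists, not_forall, not_le] at h
  obtain ⟨t, ht⟩ := h N
  exact ⟨t.mapLeaves fun e _ => (hD e).some, by rwa [Tree.depth_mapLeaves]⟩

variable (C)

/-- Selectors with values in a bounded sort decrease a suitable rank of the sorts. -/
theorem DatatypesSignature.exists_rank : ∃ (K : ℕ) (rk : C.Elem ⊕ C.Struct → ℕ),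
    (∀ σ, rk σ ≤ K) ∧ ∀ c i, C.Bounded (C.dom c i) → rk (C.dom c i) < rk (.inr (C.cod c)) := by
  classical
  have := C.finiteElem
  have := C.finiteStruct
  let d : C.Elem ⊕ C.Struct → Set ℕ := fun σ =>
    Set.range fun t : Tree C.toConstructorSignature (fun _ => Unit) σ => t.depth
  have hbdd : ∀ σ, C.Bounded σ → BddAbove (d σ) := fun σ ⟨N, hN⟩ =>
    ⟨N, by rintro _ ⟨t, rfl⟩; exact hN t⟩
  have hne : ∀ σ, Nonempty (Tree C.toConstructorSignature (fun _ => Unit) σ) :=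
    C.nonempty_tree _ fun _ => inferInstance
  obtain ⟨N, hN⟩ := (Set.finite_range fun σ => sSup (d σ)).bddAbove
  have hN' : ∀ σ, sSup (d σ) ≤ N := fun σ => hN ⟨σ, rfl⟩
  -- The rank of a bounded sort is its maximal depth; all unbounded sorts share a rank above these.
  refine ⟨N + 1, fun σ => if C.Bounded σ then sSup (d σ) else N + 1, fun σ => ?_,
    fun c i hi => ?_⟩
  · dsimp only
    split_ifs
    exacts [(hN' σ).trans (Nat.le_succ N), le_rfl]
  · dsimp only
    rw [if_pos hi]
    split_ifs with hc
    -- Put a deepest tree in position `i` and, by well-foundedness of the signature, arbitrary trees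
    -- elsewhere: the result is deeper by at least one.
    · obtain ⟨t, ht⟩ := Nat.sSup_mem (s := d (C.dom c i)) (Set.range_nonempty_iff_nonempty.2 (hne _))
        (hbdd _ hi)
      have h1 := Tree.depth_lt (Function.update (fun j => (hne (C.dom c j)).some) i t) i
      rw [Function.update_self] at h1
      rw [← ht]
      exact h1.trans_le (le_csSup (hbdd _ hc) ⟨_, rfl⟩)
    · exact Nat.lt_succ_of_le (hN' _)

end Bounded

/-! ### Replacing subtrees by new trees -/

section Graft

variable {C : DatatypesSignature} {D D' : C.Elem → Type w}

/-- Over any finite set of trees of unbounded sorts, one may choose trees that are deep, and whose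
depths are far apart. -/
theorem DatatypesSignature.exists_fresh (hD' : ∀ e, Nonempty (D' e)) (M : ℕ)
    {Y : Set (Σ σ, Tree C.toConstructorSignature D σ)} (hfin : Y.Finite)
    (hY : ∀ p ∈ Y, ¬ C.Bounded p.1) :
    ∃ fresh : ∀ p : Σ σ, Tree C.toConstructorSignature D σ, Tree C.toConstructorSignature D' p.1,
      ∀ p ∈ Y, M < (fresh p).depth ∧
        ∀ q ∈ Y, q ≠ p → ∀ k ≤ M, (fresh p).depth ≠ (fresh q).depth + k := by
  classical
  induction Y, hfin using Set.Finite.induction_on with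
  | empty => exact ⟨fun p => (C.nonempty_tree D' hD' _).some, by simp⟩
  | @insert p Y hp hfin ih =>
    obtain ⟨fresh, hf⟩ := ih fun q hq => hY q (.inr hq)
    obtain ⟨N, hN⟩ := (hfin.image fun q => (fresh q).depth).bddAbove
    -- The new tree is more than `M` deeper than all earlier ones, which gives both inequalities.
    obtain ⟨t, ht⟩ := C.exists_depth_gt (hY p (.inl rfl)) hD' (N + M)
    have hlt : ∀ q ∈ Y, (fresh q).depth + M < t.depth := fun q hq =>
      (Nat.add_le_add_right (hN ⟨q, hq, rfl⟩) M).trans_lt ht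
    have hne : ∀ q ∈ Y, q ≠ p := fun q hq h => hp (h ▸ hq)
    refine ⟨Function.update fresh p t, ?_⟩
    rintro q (rfl | hq)
    · rw [Function.update_self]
      refine ⟨by omega, ?_⟩
      rintro r (rfl | hr) hrq k hk
      · exact absurd rfl hrq
      · rw [Function.update_of_ne hrq]
        have := hlt r hr
        omega
    · rw [Function.update_of_ne (hne q hq)]
      refine ⟨(hf q hq).1, ?_⟩
      rintro r (rfl | hr) hrq k hk
      · rw [Function.update_self]
        have := hlt q hq
        omega
      · rw [Function.update_of_ne (hne r hr)]
        exact (hf q hq).2 r hr hrq k hk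

open Classical in
/-- Replacing the maximal subtrees that are not in `X`, and the leaves. -/
noncomputable def Tree.graft {C : ConstructorSignature} {D D' : C.Elem → Type w}
    (X : ∀ σ, Set (Tree C D σ)) (g : ∀ e, D e → D' e)
    (fresh : ∀ p : Σ σ, Tree C D σ, Tree C D' p.1) :
    {σ : C.Elem ⊕ C.Struct} → Tree C D σ → Tree C D' σ
  | _, .leaf e a => .leaf e (g e a)
  | _, .node c ts =>
    if Tree.node c ts ∈ X _ then .node c fun i => (ts i).graft X g fresh else fresh ⟨_, .node c ts⟩

theorem Tree.graft_node {C : ConstructorSignature} {D D' : C.Elem → Type w}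
    {X : ∀ σ, Set (Tree C D σ)} {g : ∀ e, D e → D' e}
    {fresh : ∀ p : Σ σ, Tree C D σ, Tree C D' p.1} {c : C.Con} {ts : ∀ i, Tree C D (C.dom c i)}
    (h : Tree.node c ts ∈ X _) :
    (Tree.node c ts).graft X g fresh = .node c fun i => (ts i).graft X g fresh :=
  if_pos h

/-- Only a collision between a fresh tree and the graft of a member of `X` could break injectivity.
The latter is either at most `M` deep or deeper than some fresh tree by between `1` and `M`, and the
spacing of the fresh depths excludes both. -/
theorem Tree.graft_injOn {X : ∀ σ, Set (Tree C.toConstructorSignature D σ)}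
    {g : ∀ e, D e → D' e}
    {fresh : ∀ p : Σ σ, Tree C.toConstructorSignature D σ, Tree C.toConstructorSignature D' p.1}
    {Y : Set (Σ σ, Tree C.toConstructorSignature D σ)} {M : ℕ}
    (hg : ∀ e a b, Tree.leaf e a ∈ X _ → Tree.leaf e b ∈ X _ → g e a = g e b → a = b)
    (hM : ∀ σ, ∀ t ∈ X σ, t.depth ≤ M)
    (hYX : ∀ p ∈ Y, p.2 ∉ X p.1) (hY : ∀ p ∈ Y, ¬ C.Bounded p.1)
    (hXY : ∀ c ts, Tree.node c ts ∈ X _ → ∀ i, ts i ∈ X _ ∨ ⟨_, ts i⟩ ∈ Y)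
    (hf : ∀ p ∈ Y, M < (fresh p).depth ∧
      ∀ q ∈ Y, q ≠ p → ∀ k ≤ M, (fresh p).depth ≠ (fresh q).depth + k)
    (σ : C.Elem ⊕ C.Struct) :
    Set.InjOn (Tree.graft X g fresh) (X σ) := by
  have graft_Y : ∀ {σ} (t : Tree C.toConstructorSignature D σ),
      (⟨σ, t⟩ : Σ σ, Tree C.toConstructorSignature D σ) ∈ Y →
        t.graft X g fresh = fresh ⟨σ, t⟩ := by
    intro σ t ht
    cases t with
    | leaf e a => exact absurd (C.bounded_inl e) (hY _ ht)
    | node c ts => exact if_neg (hYX _ ht)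
  -- Follow a deepest child of the graft downwards: the path either avoids the fresh trees or enters
  -- one after `k` steps.
  have depth_graft : ∀ {σ} (t : Tree C.toConstructorSignature D σ), t ∈ X σ →
      (t.graft X g fresh).depth ≤ t.depth ∨ ∃ p ∈ Y, ∃ k, 1 ≤ k ∧ k ≤ t.depth ∧
        (t.graft X g fresh).depth = (fresh p).depth + k := by
    intro σ t
    induction t with
    | leaf e a => exact fun _ => .inl le_rfl
    | node c ts ih =>
      intro ht
      rw [graft_node ht]
      rcases exists_depth_node fun i => (ts i).graft X g fresh with h | ⟨i, h⟩
      · exact .inl (h.trans_le (Nat.succ_le_succ (Nat.zero_le _)))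
      · have hlt := depth_lt ts i
        rcases hXY c ts ht i with hi | hi
        · rcases ih i hi with h' | ⟨p, hp, k, hk1, hk2, h'⟩
          · exact .inl (by omega)
          · exact .inr ⟨p, hp, k + 1, by omega, by omega, by omega⟩
        · exact .inr ⟨_, hi, 1, le_rfl, by omega, by rw [h, graft_Y _ hi]⟩
  have no_clash : ∀ {σ} {t u : Tree C.toConstructorSignature D σ},
      (⟨σ, t⟩ : Σ σ, Tree C.toConstructorSignature D σ) ∈ Y → u ∈ X σ →
        t.graft X g fresh ≠ u.graft X g fresh := by
    intro σ t u ht hu h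
    have hu' := hM σ u hu
    obtain ⟨h1, h2⟩ := hf _ ht
    rw [graft_Y t ht] at h
    rcases depth_graft u hu with h3 | ⟨p, hp, k, hk1, hk2, h3⟩
    · rw [← h] at h3
      omega
    · rw [← h] at h3
      by_cases hpt : p = ⟨σ, t⟩
      · subst hpt
        omega
      · exact h2 p hp hpt k (by omega) h3
  -- The induction must run over `X` and `Y` together, since children of members of `X` may lie in
  -- `Y`.
  suffices ∀ t u : Tree C.toConstructorSignature D σ,
      (t ∈ X σ ∨ (⟨σ, t⟩ : Σ σ, Tree C.toConstructorSignature D σ) ∈ Y) →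
      (u ∈ X σ ∨ (⟨σ, u⟩ : Σ σ, Tree C.toConstructorSignature D σ) ∈ Y) →
        t.graft X g fresh = u.graft X g fresh → t = u from
    fun t ht u hu h => this t u (.inl ht) (.inl hu) h
  intro t
  induction t with
  | leaf e a =>
    rintro u (ht | ht) (hu | hu) h
    · obtain ⟨b, rfl⟩ := u.exists_leaf
      simp only [graft, leaf.injEq] at h
      rw [hg e a b ht hu h]
    · exact absurd (C.bounded_inl e) (hY _ hu)
    · exact absurd (C.bounded_inl e) (hY _ ht)
    · exact absurd (C.bounded_inl e) (hY _ ht)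
  | node c ts ih =>
    rintro u (ht | ht) (hu | hu) h
    · have head_graft : ∀ {σ} (u : Tree C.toConstructorSignature D σ), u ∈ X σ →
          (u.graft X g fresh).head = u.head := by
        intro σ u hu
        cases u with
        | leaf e a => rfl
        | node d us => rw [graft_node hu]; rfl
      obtain ⟨us, rfl⟩ : ∃ us, u = .node c us := by
        rw [← head_eq_some, ← head_graft u hu, ← h, head_graft _ ht]
        rfl
      rw [graft_node ht, graft_node hu, node.injEq] at h
      congr 1
      exact funext fun i => ih i (us i) (hXY c ts ht i) (hXY c us hu i) (congrFun h i)
    · exact absurd h.symm (no_clash hu ht)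
    · exact absurd h (no_clash ht hu)
    · by_contra hne
      -- Spacing with `k = 0`: different members of `Y` have fresh trees of different depths.
      refine (hf _ ht).2 _ hu (fun h' => hne ?_) 0 (Nat.zero_le _) ?_
      · simpa using h'.symm
      · rw [← graft_Y _ ht, ← graft_Y _ hu, h, add_zero]

end Graft

/-! ### Selecting subtrees of bounded sorts -/

section Witness

variable (C : DatatypesSignature)

/-- The number of rounds that closes a list of terms under the selectors to bounded sorts. -/
noncomputable def DatatypesSignature.rounds : ℕ := C.exists_rank.choose

open Classical in
/-- The selectors to bounded sorts. -/
noncomputable def DatatypesSignature.boundedSels : List ((c : C.Con) × Fin (C.arity c)) :=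
  have := C.finiteCon
  (Set.toFinite {s : (c : C.Con) × Fin (C.arity c) | C.Bounded (C.dom s.1 s.2)}).toFinset.toList

variable {C} in
/-- The variable of index `0` of an element sort. -/
def DatatypesSignature.elemVar (e : C.Elem) : STerm C.sig :=
  ⟨_, Term.var (L := C.sig) (Sum.inl e : C.Elem ⊕ C.Struct) 0⟩

/-- The variables of index `0` of the element sorts. -/
noncomputable def DatatypesSignature.elemVars : List (STerm C.sig) :=
  have := C.finiteElem
  (Set.toFinite (Set.univ : Set C.Elem)).toFinset.toList.map elemVar

variable {C}

theorem DatatypesSignature.mem_boundedSels {s : (c : C.Con) × Fin (C.arity c)} :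
    s ∈ C.boundedSels ↔ C.Bounded (C.dom s.1 s.2) := by
  simp [boundedSels]

theorem DatatypesSignature.mem_elemVars {r : STerm C.sig} :
    r ∈ C.elemVars ↔ ∃ e, r = elemVar e := by
  simp [elemVars, eq_comm]

/-- The application of a selector to a term. -/
def DatatypesSignature.selTerm (s : (c : C.Con) × Fin (C.arity c))
    (t : Term C.sig (.inr (C.cod s.1))) : STerm C.sig :=
  ⟨C.dom s.1 s.2, .app (L := C.sig) (.inr s) fun _ => t⟩

open Classical in
/-- The application of a selector to a term, if that is well-sorted. -/
noncomputable def DatatypesSignature.selection (r : STerm C.sig)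
    (s : (c : C.Con) × Fin (C.arity c)) : Option (STerm C.sig) :=
  if h : r.1 = .inr (C.cod s.1) then some (selTerm s (h ▸ r.2)) else none

theorem DatatypesSignature.selection_mk (s : (c : C.Con) × Fin (C.arity c))
    (t : Term C.sig (.inr (C.cod s.1))) : selection ⟨_, t⟩ s = some (selTerm s t) :=
  dif_pos rfl

theorem DatatypesSignature.selection_of_ne {r : STerm C.sig} {s : (c : C.Con) × Fin (C.arity c)}
    (h : r.1 ≠ .inr (C.cod s.1)) : selection r s = none :=
  dif_neg h

/-- The applications of the selectors to bounded sorts to a term. -/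
noncomputable def DatatypesSignature.selections (r : STerm C.sig) : List (STerm C.sig) :=
  C.boundedSels.filterMap (selection r)

theorem DatatypesSignature.mem_selections {r q : STerm C.sig} :
    q ∈ selections r ↔ ∃ s : (c : C.Con) × Fin (C.arity c), C.Bounded (C.dom s.1 s.2) ∧
      ∃ t, r = ⟨.inr (C.cod s.1), t⟩ ∧ q = selTerm s t := by
  simp only [selections, List.mem_filterMap, mem_boundedSels]
  refine exists_congr fun s => and_congr_right fun _ => ⟨fun h => ?_, ?_⟩
  · obtain ⟨σ, t⟩ := r
    by_cases hσ : σ = .inr (C.cod s.1)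
    · subst hσ
      rw [selection_mk] at h
      exact ⟨t, rfl, (Option.some.inj h).symm⟩
    · rw [selection_of_ne hσ] at h
      cases h
  · rintro ⟨t, rfl, rfl⟩
    exact selection_mk s t

/-! ### Shrinking the element sorts -/

/-- The immediate subtrees. -/
def Tree.children {C : ConstructorSignature} {D : C.Elem → Type w} :
    (Σ σ, Tree C D σ) → Set (Σ σ, Tree C D σ)
  | ⟨_, .leaf _ _⟩ => ∅
  | ⟨_, .node _ ts⟩ => Set.range fun i => ⟨_, ts i⟩

theorem Tree.finite_children {C : ConstructorSignature} {D : C.Elem → Type w}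
    (p : Σ σ, Tree C D σ) : (Tree.children p).Finite := by
  obtain ⟨_, t⟩ := p
  cases t
  exacts [Set.finite_empty, Set.finite_range _]

/-- Let `F` be a finite set of variables, and `R` a finite set of terms that is closed under
subterms and under the selectors to bounded sorts. If every term of an element sort in `R` has
the value of a variable in `F`, then one may shrink the element sorts to the values of the
variables in `F`. -/
theorem DatatypesSignature.exists_shrink {D : C.Elem → Type w} {hD : ∀ e, Nonempty (D e)}
    {sel : (c : C.Con) → (i : Fin (C.arity c)) → Tree C.toConstructorSignature D (.inr (C.cod c)) →
      Tree C.toConstructorSignature D (C.dom c i)}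
    (hsel : ∀ c i ts, sel c i (.node c ts) = ts i)
    (v : (C.treeStructure D hD sel).Valuation)
    {R : Set (STerm C.sig)} (hfin : R.Finite) (hR : ∀ r ∈ R, ∀ s ∈ r.args, s ∈ R)
    (hRsel : ∀ r ∈ R, ∀ s ∈ selections r, s ∈ R)
    {F : Set (Var C.sig)} (hF : ∀ e : C.Elem, ∃ n, (Sum.inl e, n) ∈ F)
    (hRF : ∀ (e : C.Elem) (t : Term C.sig (.inl e)), (⟨.inl e, t⟩ : STerm C.sig) ∈ R →
      ∃ n, (Sum.inl e, n) ∈ F ∧ v (.inl e) n = (C.treeStructure D hD sel).eval v t) :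
    ∃ (B : Structure.{w} C.sig) (v' : B.Valuation), B ∈ theory.{w} C ∧
      (∀ φ : QF C.sig, φ.TermsIn R → (B.Sat v' φ ↔ (C.treeStructure D hD sel).Sat v φ)) ∧
      ∀ σ ∈ C.elemSorts,
        (Set.univ : Set (B.carrier σ)) = {a | ∃ n, (σ, n) ∈ F ∧ v' σ n = a} := by
  classical
  let P : (e : C.Elem) → D e → Prop := fun e a => ∃ n, (Sum.inl e, n) ∈ F ∧ v (.inl e) n = .leaf e a
  let D' : C.Elem → Type w := fun e => {a : D e // P e a}
  have hD' : ∀ e, Nonempty (D' e) := fun e => by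
    obtain ⟨n, hn⟩ := hF e
    obtain ⟨a, ha⟩ := Tree.exists_leaf (v (.inl e) n)
    exact ⟨⟨a, n, hn, ha⟩⟩
  -- The default value is harmless: leaves in `X` satisfy `P`, and only on those must `g` be
  -- injective.
  let g : ∀ e, D e → D' e := fun e a => if h : P e a then ⟨a, h⟩ else (hD' e).some
  have hg : ∀ e a (h : P e a), g e a = ⟨a, h⟩ := fun e a h => dif_pos h
  let X : ∀ σ, Set (Tree C.toConstructorSignature D σ) := fun σ =>
    {x | ∃ t : Term C.sig σ, (⟨σ, t⟩ : STerm C.sig) ∈ R ∧ (C.treeStructure D hD sel).eval v t = x}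
  let X' : Set (Σ σ, Tree C.toConstructorSignature D σ) :=
    (fun r : STerm C.sig => ⟨r.1, (C.treeStructure D hD sel).eval v r.2⟩) '' R
  have hX' : ∀ {σ x}, x ∈ X σ → (⟨σ, x⟩ : Σ σ, Tree C.toConstructorSignature D σ) ∈ X' := by
    rintro σ _ ⟨t, ht, rfl⟩
    exact ⟨_, ht, rfl⟩
  have hXX' : ∀ {q}, q ∈ X' → q.2 ∈ X q.1 := by
    rintro _ ⟨r, hr, rfl⟩
    exact ⟨_, hr, rfl⟩
  have hX'fin : X'.Finite := hfin.image _
  obtain ⟨M, hM⟩ := (hX'fin.image fun p => p.2.depth).bddAbove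
  let Y : Set (Σ σ, Tree C.toConstructorSignature D σ) :=
    {p | (∃ q ∈ X', p ∈ Tree.children q) ∧ p.2 ∉ X p.1}
  have hYfin : Y.Finite :=
    (hX'fin.biUnion fun q _ => Tree.finite_children q).subset fun p hp => by
      simpa using hp.1
  have hleaf : ∀ e a, Tree.leaf e a ∈ X (.inl e) → P e a := by
    rintro e a ⟨t, ht, h⟩
    obtain ⟨n, hn, h'⟩ := hRF e t ht
    exact ⟨n, hn, h'.trans h⟩
  -- Closure of `R` under selectors into bounded sorts is used here: the child is the value of a
  -- selector term.
  have hchild : ∀ c ts, Tree.node c ts ∈ X (.inr (C.cod c)) → ∀ i, C.Bounded (C.dom c i) →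
      ts i ∈ X (C.dom c i) := by
    rintro c ts ⟨t, ht, h⟩ i hi
    refine ⟨(selTerm ⟨c, i⟩ t).2, hRsel _ ht _ (mem_selections.2 ⟨⟨c, i⟩, hi, t, rfl, rfl⟩), ?_⟩
    exact (congrArg (sel c i) h).trans (hsel c i ts)
  have hYbdd : ∀ p ∈ Y, ¬ C.Bounded p.1 := by
    rintro p ⟨⟨⟨σ, x⟩, hq, hp⟩, hpX⟩ hb
    cases x with
    | leaf e a => exact hp
    | node c ts =>
      obtain ⟨i, rfl⟩ := hp
      exact hpX (hchild c ts (hXX' hq) i hb)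
  obtain ⟨fresh, hfresh⟩ := C.exists_fresh hD' M hYfin hYbdd
  obtain ⟨sel', hsel', H⟩ := C.exists_transfer hD' hsel v (fun σ => Tree.graft X g fresh) R hR X
    (fun r hr => ⟨_, hr, rfl⟩)
    (Tree.graft_injOn (Y := Y) (M := M)
      (fun e a b ha hb h => by
        rw [hg e a (hleaf e a ha), hg e b (hleaf e b hb)] at h
        exact congrArg Subtype.val h)
      (fun σ t ht => hM ⟨_, hX' ht, rfl⟩) (fun p hp => hp.2) hYbdd
      (fun c ts h i => or_iff_not_imp_left.2 fun hi =>
        ⟨⟨_, hX' h, i, rfl⟩, hi⟩)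
      hfresh)
    (fun c ts h => Tree.graft_node h)
  refine ⟨_, _, ⟨D', hD', sel', hsel', rfl⟩, H, ?_⟩
  rintro _ ⟨e, rfl⟩
  refine (Set.eq_univ_of_forall fun x => ?_).symm
  obtain ⟨⟨a, n, hn, ha⟩, rfl⟩ := Tree.exists_leaf x
  refine ⟨n, hn, ?_⟩
  exact (congrArg (Tree.graft X g fresh) ha).trans (congrArg (Tree.leaf e) (hg e a _))

/-! ### The witness function -/

variable [Encodable C.sig.Srt] [Encodable C.sig.Fn] [Encodable C.sig.Pr]

/-- The subterms of `φ` and the variables of index `0` of the element sorts, closed under the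
selectors to bounded sorts. -/
noncomputable def DatatypesSignature.relevantTerms (φ : QF C.sig) : List (STerm C.sig) :=
  saturate selections C.rounds (saturate STerm.args φ.code (C.elemVars ++ φ.topTerms))

open Classical in
/-- The equation of a term of an element sort and a variable of index greater than `k`. -/
noncomputable def DatatypesSignature.naming (k : ℕ) (r : STerm C.sig) : Option (QF C.sig) :=
  -- The summand `k + 1` puts the name beyond the old variables; `r.code` separates names of
  -- different terms.
  if r.1 ∈ C.elemSorts then some (.eq (.var r.1 (k + r.code + 1)) r.2) else none

/-- The conjunction of `φ` with names for the relevant terms of element sorts. -/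
noncomputable def DatatypesSignature.wtn (φ : QF C.sig) : QF C.sig :=
  .and φ (QF.conj ((relevantTerms φ).filterMap (naming φ.code)))

theorem DatatypesSignature.mem_namings {φ ψ : QF C.sig} :
    ψ ∈ (relevantTerms φ).filterMap (naming φ.code) ↔
      ∃ r ∈ relevantTerms φ, r.1 ∈ C.elemSorts ∧
        ψ = .eq (.var r.1 (φ.code + r.code + 1)) r.2 := by
  simp only [List.mem_filterMap, naming]
  refine exists_congr fun r => and_congr_right fun _ => ?_
  by_cases h : r.1 ∈ C.elemSorts
  · simp [h, eq_comm]
  · simp [h]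

/-- The only immediate subterm of a new selector term is the term it was applied to, present one
round earlier; so closing under selectors keeps closure under subterms. -/
theorem DatatypesSignature.mem_relevantTerms_of_mem_args {φ : QF C.sig} {r s : STerm C.sig}
    (hr : r ∈ relevantTerms φ) (hs : s ∈ r.args) : s ∈ relevantTerms φ := by
  have closed₁ : ∀ {r s : STerm C.sig},
      r ∈ saturate STerm.args φ.code (C.elemVars ++ φ.topTerms) → s ∈ r.args →
        s ∈ saturate STerm.args φ.code (C.elemVars ++ φ.topTerms) := by
    intro r s hr hs
    -- the rank of a variable is irrelevant, since it has no arguments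
    refine saturate_closed (rk := fun r => if r.args = [] then 0 else r.code) ?_ ?_ hr hs
    · intro a ha
      rcases List.mem_append.1 ha with ha | ha
      · obtain ⟨e, rfl⟩ := mem_elemVars.1 ha
        exact Nat.zero_le _
      · split_ifs
        exacts [Nat.zero_le _, QF.code_le_of_mem_topTerms ha]
    · intro a b hb
      have := STerm.code_lt_of_mem_args hb
      rw [if_neg (List.ne_nil_of_mem hb)]
      split_ifs <;> omega
  rw [relevantTerms] at hr ⊢
  generalize C.rounds = k at hr ⊢
  induction k generalizing r with
  | zero => exact closed₁ hr hs
  | succ k ih =>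
    rcases mem_saturate_succ.1 hr with hr | ⟨q, hq, hrq⟩
    · exact saturate_mono _ _ (Nat.le_succ k) (ih hs hr)
    · obtain ⟨s', -, t, rfl, rfl⟩ := mem_selections.1 hrq
      obtain ⟨i, rfl⟩ := List.mem_ofFn.1 hs
      exact saturate_mono _ _ (Nat.le_succ k) hq

/-- `C.rounds` bounds the rank of the sorts, which each selection lowers. -/
theorem DatatypesSignature.mem_relevantTerms_of_mem_selections {φ : QF C.sig}
    {r q : STerm C.sig} (hr : r ∈ relevantTerms φ) (hq : q ∈ selections r) :
    q ∈ relevantTerms φ := by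
  obtain ⟨rk, hK, hrk⟩ := C.exists_rank.choose_spec
  refine saturate_closed (rk := fun r => rk r.1) (fun r _ => hK r.1) ?_ hr hq
  intro a b hb
  obtain ⟨s, hs, t, rfl, rfl⟩ := mem_selections.1 hb
  exact hrk s.1 s.2 hs

theorem DatatypesSignature.mem_relevantTerms_of_mem_topTerms {φ : QF C.sig} {r : STerm C.sig}
    (hr : r ∈ φ.topTerms) : r ∈ relevantTerms φ :=
  mem_saturate_of_mem _ _ (mem_saturate_of_mem _ _ (List.mem_append_right _ hr))

theorem DatatypesSignature.elemVar_mem_relevantTerms (φ : QF C.sig) (e : C.Elem) :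
    elemVar e ∈ relevantTerms φ :=
  mem_saturate_of_mem _ _ (mem_saturate_of_mem _ _
    (List.mem_append_left _ (mem_elemVars.2 ⟨e, rfl⟩)))

/-- Ensures that reassigning the names does not change the values of the terms they name. -/
theorem DatatypesSignature.le_code_of_mem_relevantTerms {φ : QF C.sig} :
    ∀ r ∈ relevantTerms φ, ∀ σ n, (σ, n) ∈ r.2.vars → n ≤ φ.code := by
  refine saturate_induction (saturate_induction ?_ ?_ _) ?_ _
  · intro r hr σ n hn
    rcases List.mem_append.1 hr with hr | hr
    · obtain ⟨e, rfl⟩ := mem_elemVars.1 hr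
      obtain ⟨-, rfl⟩ := Prod.mk.inj (Set.mem_singleton_iff.1 hn)
      exact Nat.zero_le _
    · exact (Term.le_code_of_mem_vars hn).trans (QF.code_le_of_mem_topTerms hr)
  · rintro ⟨σ, t⟩ ih s hs τ n hn
    cases t with
    | var => simp [STerm.args] at hs
    | app f ts =>
      obtain ⟨i, rfl⟩ := List.mem_ofFn.1 hs
      exact ih τ n (Set.mem_iUnion.2 ⟨i, hn⟩)
  · rintro r ih q hq τ n hn
    obtain ⟨s, -, t, rfl, rfl⟩ := mem_selections.1 hq
    obtain ⟨i, hi⟩ := Set.mem_iUnion.1 hn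
    exact ih τ n hi

/-! ### Computability of the witness function -/

variable (C) in
theorem DatatypesSignature.computable_wtn : ComputableQF (wtn (C := C)) := by
  classical
  have := C.finiteElem
  have := C.finiteStruct
  have := C.finiteCon
  have : Finite C.sig.Srt := inferInstanceAs (Finite (C.Elem ⊕ C.Struct))
  have : Finite C.sig.Fn :=
    inferInstanceAs (Finite (C.Con ⊕ (c : C.Con) × Fin (C.arity c)))
  obtain ⟨F, hF, hF'⟩ := exists_primrec_encode fun f : C.sig.Fn => Encodable.encode (C.sig.fnCod f)
  obtain ⟨E, hE, hE'⟩ := exists_primrec_encode fun σ : C.sig.Srt =>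
    if σ ∈ C.elemSorts then 1 else 0
  -- A constant list, fixed by the signature: boundedness is never decided by the algorithm.
  let sels : List (ℕ × ℕ) := C.boundedSels.map fun s =>
    (Encodable.encode (α := C.sig.Fn) (.inr s), Encodable.encode (α := C.sig.Srt) (.inr (C.cod s.1)))
  let selectionsCode : ℕ → List ℕ := fun n => sels.filterMap fun p =>
    if sortCode F n = p.2 then some (Nat.pair 1 (Nat.pair p.1 (Encodable.encode [n]))) else none
  let relevantCode : ℕ → List ℕ := fun n => saturate selectionsCode C.rounds
    (saturate argsCode n (C.elemVars.map STerm.code ++ topTermsCode n))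
  let namingCode : ℕ → ℕ → Option ℕ := fun k n =>
    if E (sortCode F n) = 1 then
      some (Nat.pair 1 (Nat.pair (Nat.pair 0 (Nat.pair (sortCode F n) (k + n + 1))) n)) else none
  have hsort := sortCode_code hF'
  have sort_prim := primrec_sortCode hF
  refine ⟨fun n => Nat.pair 4 (Nat.pair n (conjCode ((relevantCode n).filterMap (namingCode n)))),
    Primrec.to_comp ?_, fun φ => ?_⟩
  · have h1 : Primrec selectionsCode := by
      refine Primrec.listFilterMap (Primrec.const _) (Primrec.ite
        (Primrec.eq.comp (sort_prim.comp Primrec.fst) (Primrec.snd.comp Primrec.snd))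
        (Primrec.option_some.comp (Primrec₂.natPair.comp (Primrec.const 1) (Primrec₂.natPair.comp
          (Primrec.fst.comp Primrec.snd) (Primrec.encode.comp
            (Primrec.list_cons.comp Primrec.fst (Primrec.const []))))))
        (Primrec.const none))
    have h2 : Primrec relevantCode :=
      primrec_saturate h1 (Primrec.const _) (primrec_saturate primrec_argsCode Primrec.id
        (Primrec.list_append.comp (Primrec.const _) primrec_topTermsCode))
    have h3 : Primrec₂ namingCode :=
      Primrec.ite (Primrec.eq.comp (hE.comp (sort_prim.comp Primrec.snd)) (Primrec.const 1))
        (Primrec.option_some.comp (Primrec₂.natPair.comp (Primrec.const 1) (Primrec₂.natPair.comp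
          (Primrec₂.natPair.comp (Primrec.const 0) (Primrec₂.natPair.comp
            (sort_prim.comp Primrec.snd)
            (Primrec.succ.comp (Primrec.nat_add.comp Primrec.fst Primrec.snd)))) Primrec.snd)))
        (Primrec.const none)
    exact Primrec₂.natPair.comp (Primrec.const 4) (Primrec₂.natPair.comp Primrec.id
      (primrec_conjCode.comp (Primrec.listFilterMap h2 h3)))
  · have h1 : ∀ r : STerm C.sig, selectionsCode r.code = (selections r).map STerm.code := by
      intro r
      simp only [selectionsCode, sels, selections, List.filterMap_map, List.map_filterMap]
      congr 1
      funext s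
      simp only [Function.comp_apply, hsort]
      obtain ⟨σ, t⟩ := r
      by_cases h : σ = .inr (C.cod s.1)
      · subst h
        rw [selection_mk]
        exact if_pos rfl
      · rw [selection_of_ne h]
        exact if_neg fun h' => h (Encodable.encode_injective h')
    have h2 : relevantCode φ.code = (relevantTerms φ).map STerm.code := by
      simp only [relevantCode, relevantTerms]
      rw [map_saturate h1, map_saturate argsCode_code, List.map_append, topTermsCode_code]
    have h3 : ∀ r : STerm C.sig,
        namingCode φ.code r.code = (naming φ.code r).map QF.code := by
      intro r
      simp only [namingCode, naming, hsort, hE']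
      by_cases h : r.1 ∈ C.elemSorts
      · simp [h, QF.code, Term.code, STerm.code]
      · simp [h]
    have h4 : (relevantCode φ.code).filterMap (namingCode φ.code) =
        ((relevantTerms φ).filterMap (naming φ.code)).map QF.code := by
      rw [h2, List.filterMap_map, List.map_filterMap]
      exact congrArg (fun f => List.filterMap f _) (funext h3)
    simp only [wtn, QF.code, h4, conjCode_code]

/-! ### Correctness of the witness function -/

theorem DatatypesSignature.sat_iff_satEx_wtn (φ : QF C.sig) (A : Structure.{w} C.sig)
    (v : A.Valuation) : A.Sat v φ ↔ A.SatEx v ((wtn φ).fv \ φ.fv) (wtn φ) := by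
  classical
  constructor
  · intro hφ
    -- Membership in the witness variables is required so that `v'` changes nothing else.
    let P : (σ : C.sig.Srt) → ℕ → Term C.sig σ → Prop := fun σ n t =>
      (σ, n) ∈ (wtn φ).fv \ φ.fv ∧ n = φ.code + STerm.code ⟨σ, t⟩ + 1
    let v' : A.Valuation := fun σ n => if h : ∃ t, P σ n t then A.eval v h.choose else v σ n
    have hv' : ∀ σ n, n ≤ φ.code → v' σ n = v σ n := by
      intro σ n hn
      refine dif_neg ?_
      rintro ⟨t, -, h⟩
      omega
    refine ⟨v', fun σ n hn => dif_neg fun ⟨t, h, _⟩ => hn h, ?_, Structure.sat_conj.2 ?_⟩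
    · exact (Structure.sat_congr fun σ n hn => hv' σ n (QF.le_code_of_mem_fv hn)).2 hφ
    · intro ψ hψ
      obtain ⟨⟨σ, t⟩, hr, hσ, rfl⟩ := mem_namings.1 hψ
      have hP : ∃ u, P σ (φ.code + STerm.code ⟨σ, t⟩ + 1) u := by
        refine ⟨t, ⟨.inr (QF.mem_fv_conj.2 ⟨_, hψ, .inl rfl⟩), fun h => ?_⟩, rfl⟩
        have := QF.le_code_of_mem_fv h
        omega
      have heq : hP.choose = t := by
        have h := hP.choose_spec.2
        have h' := STerm.code_injective (a₁ := ⟨σ, t⟩) (a₂ := ⟨σ, hP.choose⟩) (by omega)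
        simpa using h'.symm
      change v' σ _ = A.eval v' t
      rw [Structure.eval_congr fun τ n hn => hv' τ n (le_code_of_mem_relevantTerms _ hr τ n hn)]
      exact (dif_pos hP).trans (by rw [heq])
  · rintro ⟨v', hv', h, -⟩
    exact (Structure.sat_congr fun σ n hn => hv' σ n fun h => h.2 hn).1 h

variable (C) in
theorem DatatypesSignature.isStrongWitness_wtn :
    (theory.{w} C).IsStrongWitness C.elemSorts (wtn (C := C)) := by
  refine fun φ => ⟨fun A v _ => sat_iff_satEx_wtn φ A v, ?_⟩
  intro V δ hV hδ
  refine or_iff_not_imp_left.2 fun hsat => ?_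
  obtain ⟨A, v, ⟨D, hD, sel, hsel, rfl⟩, hA⟩ := not_not.1 hsat
  let F : Set (Var C.sig) := (QF.and (wtn φ) δ).fv
  let R₁ : Set (STerm C.sig) := {r | r ∈ relevantTerms φ}
  -- These variables make the naming equations and the literals of `δ` formulas over `R₁ ∪ R₂`. They
  -- have no subterms to add, and no selector applies to an element sort, so the closure conditions
  -- survive.
  let R₂ : Set (STerm C.sig) := (fun x : Var C.sig => ⟨x.1, .var x.1 x.2⟩) ''
    {x | x ∈ F ∧ x.1 ∈ C.elemSorts}
  have hname : ∀ r ∈ R₁, r.1 ∈ C.elemSorts → (r.1, φ.code + r.code + 1) ∈ F ∧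
      v r.1 (φ.code + r.code + 1) = (C.treeStructure D hD sel).eval v r.2 := by
    intro r hr hσ
    have hmem := mem_namings.2 ⟨r, hr, hσ, rfl⟩
    exact ⟨.inl (.inr (QF.mem_fv_conj.2 ⟨_, hmem, .inl rfl⟩)),
      Structure.sat_conj.1 hA.1.2 _ hmem⟩
  obtain ⟨B, v', hB, hsat', hspan⟩ := C.exists_shrink hsel v (R := R₁ ∪ R₂) (F := F)
    ((List.finite_toSet _).union (((QF.finite_fv _).subset fun x hx => hx.1).image _))
    (by
      rintro r (hr | ⟨x, -, rfl⟩) s hs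
      · exact .inl (mem_relevantTerms_of_mem_args hr hs)
      · simp [STerm.args] at hs)
    (by
      rintro r (hr | ⟨x, ⟨-, ⟨e, he⟩⟩, rfl⟩) s hs
      · exact .inl (mem_relevantTerms_of_mem_selections hr hs)
      · obtain ⟨s', -, t, h, -⟩ := mem_selections.1 hs
        have := he.trans (congrArg Sigma.fst h)
        simp at this)
    (fun e => ⟨_, (hname _ (elemVar_mem_relevantTerms φ e) ⟨e, rfl⟩).1⟩)
    (by
      rintro e t (hr | ⟨x, ⟨hx, -⟩, h⟩)
      · exact ⟨_, hname _ hr ⟨e, rfl⟩⟩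
      · obtain ⟨τ, n⟩ := x
        obtain ⟨rfl, h⟩ := Sigma.mk.inj h
        obtain rfl := eq_of_heq h
        exact ⟨n, hx, rfl⟩)
  refine ⟨B, v', hB, (hsat' (.and (wtn φ) δ) ⟨?_, ?_⟩).2 hA, hspan⟩
  · refine ⟨φ.termsIn_topTerms.mono fun r hr => .inl (mem_relevantTerms_of_mem_topTerms hr),
      QF.termsIn_conj.2 fun ψ hψ => ?_⟩
    obtain ⟨r, hr, hσ, rfl⟩ := mem_namings.1 hψ
    exact ⟨.inr ⟨_, ⟨(hname r hr hσ).1, hσ⟩, rfl⟩, .inl hr⟩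
  · obtain ⟨E, l, hl, rfl⟩ := hδ
    refine QF.termsIn_conj.2 fun ψ hψ => ?_
    have hvar : ∀ x ∈ V, x ∈ ψ.fv → (⟨x.1, .var x.1 x.2⟩ : STerm C.sig) ∈ R₁ ∪ R₂ :=
      fun x hxV hx => .inr ⟨x, ⟨.inr (QF.mem_fv_conj.2 ⟨ψ, hψ, hx⟩), hV x hxV⟩, rfl⟩
    obtain ⟨σ, x, y, ⟨-, rfl⟩ | ⟨-, rfl⟩⟩ := (hl ψ).1 hψ
    · exact ⟨hvar _ x.2 (.inl rfl), hvar _ y.2 (.inr rfl)⟩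
    · exact ⟨hvar _ x.2 (.inl rfl), hvar _ y.2 (.inr rfl)⟩

end Witness

end DT

theorem theorem4 (C : DT.DatatypesSignature)
    [Encodable C.sig.Srt] [Encodable C.sig.Fn] [Encodable C.sig.Pr] :
    DT.Theory.StronglyPolite (DT.DatatypesSignature.theory.{w} C) C.elemSorts :=
  ⟨C.smooth_theory, _, C.computable_wtn, C.isStrongWitness_wtn⟩
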